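/- Let $n\in\mathbb{N}$. For a set $S\subseteq\mathbb{R}^n$ and $k\in\mathbb{N}_0=\{0,1,2,\ldots\}$, the quantitative Helly number $c(S,k)$ is the smallest $t\in\mathbb{N}_0$ with the following property: whenever convex sets $C_1,\ldots,C_m\subseteq\mathbb{R}^n$ ($m\ge 1$) have exactly $k$ points of $S$ in common, there is a subset $I\subseteq\{1,\ldots,m\}$ with at most $t$ elements such that the sets $C_i$, $i\in I$, already have exactly $k$ points of $S$ in common (the intersection of the empty family being $\mathbb{R}^n$). If no such $t$ exists, put $c(S,k):=\infty$, and if no convex set contains exactly $k$ points of $S$, put $c(S,k):=-\infty$. Theorem. Let $n\ge 2$. Then $$c(\mathbb{Z}^n,0)=2^n,\qquad c(\mathbb{Z}^n,1)=c(\mathbb{Z}^n,2)=c(\mathbb{Z}^n,3)=2^{n+1}-2,\qquad c(\mathbb{Z}^n,4)=2^{n+1}.$$ -/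

import Mathlib

/-- The integer lattice `ℤ^n`, as a subset of `ℝ^n`. -/
def intLattice (n : ℕ) : Set (Fin n → ℝ) :=
  Set.range fun (z : Fin n → ℤ) (i : Fin n) => (z i : ℝ)

/-- Whenever finitely many convex sets `C_1, …, C_m` (`m ≥ 1`) of `ℝ^n` have exactly `k` points
of `S` in common, some at most `t` of them already have exactly `k` points of `S` in common.
The intersection of the empty subfamily is `ℝ^n`. -/
def IsQuantHellyBound {n : ℕ} (S : Set (Fin n → ℝ)) (k t : ℕ) : Prop :=
  ∀ (m : ℕ) (C : Fin m → Set (Fin n → ℝ)), 1 ≤ m → (∀ i, Convex ℝ (C i)) →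
    (S ∩ ⋂ i, C i).encard = (k : ℕ∞) →
      ∃ I : Finset (Fin m), I.card ≤ t ∧ (S ∩ ⋂ i ∈ I, C i).encard = (k : ℕ∞)

open Classical in
/-- The quantitative Helly number `c(S, k)`: the least `t` with `IsQuantHellyBound S k t`,
`∞` (written `⊤`) if there is no such `t`, and `-∞` (written `⊥`) if no convex set contains
exactly `k` points of `S`. -/
noncomputable def quantHelly {n : ℕ} (S : Set (Fin n → ℝ)) (k : ℕ) : WithBot ℕ∞ :=
  if ∃ C : Set (Fin n → ℝ), Convex ℝ C ∧ (S ∩ C).encard = (k : ℕ∞) then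
    if h : ∃ t : ℕ, IsQuantHellyBound S k t then ((Nat.find h : ℕ∞) : WithBot ℕ∞)
    else ((⊤ : ℕ∞) : WithBot ℕ∞)
  else ⊥

/-!
The proof reduces the quantitative Helly number of `ℤ^n` to a question on lattice points and then
counts modulo two.

*Upper bounds.* In a family of convex sets with exactly `k` common lattice points, pass to a
subfamily that is minimal with the same set `T` of common lattice points. Each of its members has a
lattice point that only this member excludes, and inside a box `A` of lattice points containing
these points and `T`, every member is cut out by finitely many open half-spaces. A minimal system
of these half-spaces with `T` as common part in `A` has at least as many members as the subfamily.
Pushing the half-spaces outwards as far as possible gives each of them a point of `A` on its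
boundary lying in all the others (`exists_boundary_points`). Let `X` be the set of these points. The
midpoint of two distinct points of `T ∪ X` lies in all half-spaces, so it belongs to `T` if it is a
lattice point; this is `MidpointsIn T X`, and everything else about the family is forgotten
(`isQuantHellyBound_of_midpointsIn`).

Two lattice points have a lattice point as midpoint if they agree modulo two, so `MidpointsIn T X`
restricts how many points of `X` lie in each of the `2 ^ n` parity classes. With at most four points
in `T`, no class has more than three. A class with three points is determined by its three
midpoints, which form a triangle in `T` (`exists_triangle`); hence such classes are few. On the
other hand, the classes of the points of `T` contain few points of `X`: none if `|T| = 1`, and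
otherwise usually at most one. If the class of `t ∈ T` has more, then either `t` is the middle point
of an arithmetic progression in `T` whose outer points have an empty class
(`card_parityClass_eq_zero`), or `T` is a parallelogram and no class has three points
(`collinear_or_parallelogram`, `card_parityClass_lt_of_parallelogram`). Adding up gives the bounds
`card_le_zero` to `card_le_four`.

*Lower bounds.* If a convex set `P` has as lattice points `k` points and further extreme points of
`P`, then the sets `P \ {x}`, where `x` is such an extreme point, form a family from which no member
can be dropped (`quantHelly_eq_of_extremePoints`). For `k = 0` the unit cube will do. For `k ≥ 1`,
take a lattice polytope `B` in the first `d` coordinates that contains the unit cube, and let `P` be the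
hull of `B` and the products of `{0, 1}^d` with the nonzero points of `{0, 1}^(n-d)` and of
`{0, -1}^(n-d)`; it has `2 * (2 ^ n - 2 ^ d)` extreme lattice points outside `B`
(`IsFiberData.quantHelly_eq`). For `k = 1`, `B` is the origin (`d = 0`), which is not extreme in
`P`. For `k = 2, 3` and `k = 4`, `B` is a segment (`d = 1`) and an octagon (`d = 2`) with `k` lattice
points besides their vertices; the vertices are extreme in `P`. -/

/-! ### Parity classes of the integer lattice -/

/-- Reduction modulo two of a lattice vector. -/
def parity (n : ℕ) : (Fin n → ℤ) →+ (Fin n → ZMod 2) where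
  toFun z i := (z i : ZMod 2)
  map_zero' := by ext; simp
  map_add' := by intros; ext; simp

lemma exists_midpoint {n : ℕ} {a b : Fin n → ℤ} (h : parity n a = parity n b) :
    ∃ c, a + b = c + c := by
  have hi : ∀ i, ∃ c : ℤ, a i + b i = c + c := by
    intro i
    have h1 : ((a i : ℤ) : ZMod 2) = (b i : ℤ) := congrFun h i
    rw [ZMod.intCast_eq_intCast_iff] at h1
    have h2 : a i % 2 = b i % 2 := h1
    exact ⟨(a i + b i) / 2, by omega⟩
  choose c hc using hi
  exact ⟨c, funext hc⟩

lemma parity_add_self {n : ℕ} (q : Fin n → ZMod 2) : q + q = 0 := by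
  ext i
  exact CharTwo.add_self_eq_zero (q i)

lemma parity_eq_of_midpoint {n : ℕ} {a b c : Fin n → ℤ} (h : a + b = c + c) :
    parity n a = parity n b := by
  have h1 := congrArg (parity n) h
  rw [map_add, map_add, parity_add_self] at h1
  have h2 := parity_add_self (parity n b)
  grind

/-- The two finite sets of lattice points are disjoint, and a lattice point that is the midpoint
of two distinct points of their union belongs to `T`. This holds if the union consists of all
lattice points of a convex set and the points of `X` are extreme points of it. -/
structure MidpointsIn {n : ℕ} (T X : Finset (Fin n → ℤ)) : Prop where
  notMem : ∀ a ∈ X, a ∉ T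
  mid : ∀ a ∈ T ∪ X, ∀ b ∈ T ∪ X, a ≠ b → ∀ c, a + b = c + c → c ∈ T

/-- The points of `X` in the parity class `q`. -/
def parityClass {n : ℕ} (X : Finset (Fin n → ℤ)) (q : Fin n → ZMod 2) : Finset (Fin n → ℤ) :=
  X.filter fun x => parity n x = q

lemma mem_parityClass {n : ℕ} {X : Finset (Fin n → ℤ)} {q : Fin n → ZMod 2} {x : Fin n → ℤ} :
    x ∈ parityClass X q ↔ x ∈ X ∧ parity n x = q := by
  simp [parityClass]

lemma card_eq_sum_parityClass {n : ℕ} (X : Finset (Fin n → ℤ)) :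
    X.card = ∑ q, (parityClass X q).card :=
  Finset.card_eq_sum_card_fiberwise (t := Finset.univ) (fun _ _ => by simp)

/-- If no parity class has more than three points, then `|X|` is at most `2 ^ (n + 1)`, plus one
for each class with three points, minus one for each class with one point, minus two for each
empty class. -/
lemma card_add_card_le {n : ℕ} {X : Finset (Fin n → ℤ)}
    (h : ∀ q, (parityClass X q).card ≤ 3) :
    X.card + (Finset.univ.filter fun q => (parityClass X q).card ≤ 1).card
      + (Finset.univ.filter fun q => (parityClass X q).card = 0).card
      ≤ 2 ^ (n + 1) + (Finset.univ.filter fun q => 3 ≤ (parityClass X q).card).card := by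
  have h2 : (2 ^ (n + 1) : ℕ) = ∑ _q : Fin n → ZMod 2, 2 := by
    simp [ZMod.card, pow_succ]
  rw [card_eq_sum_parityClass, Finset.card_filter, Finset.card_filter, Finset.card_filter, h2,
    ← Finset.sum_add_distrib, ← Finset.sum_add_distrib, ← Finset.sum_add_distrib]
  refine Finset.sum_le_sum fun q _ => ?_
  have := h q
  split_ifs <;> omega

/-! ### Sets whose midpoints lie in few points -/

namespace MidpointsIn

variable {n : ℕ} {T X : Finset (Fin n → ℤ)}

lemma exists_mid (h : MidpointsIn T X) {a b : Fin n → ℤ} (ha : a ∈ T ∨ a ∈ X)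
    (hb : b ∈ T ∨ b ∈ X) (hab : a ≠ b) (hp : parity n a = parity n b) :
    ∃ c ∈ T, a + b = c + c := by
  obtain ⟨c, hc⟩ := exists_midpoint hp
  exact ⟨c, h.mid a (Finset.mem_union.2 ha) b (Finset.mem_union.2 hb) hab c hc, hc⟩

/-- A parity class with three points consists of `s + t - r`, `r + t - s` and `r + s - t`, where
`r`, `s`, `t` are the midpoints of its points. -/
lemma exists_triangle (h : MidpointsIn T X) {q : Fin n → ZMod 2}
    (hq : 3 ≤ (parityClass X q).card) :
    ∃ r ∈ T, ∃ s ∈ T, ∃ t ∈ T, r ≠ s ∧ r ≠ t ∧ s ≠ t ∧ s + t - r ∈ X ∧ r + t - s ∈ X ∧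
      r + s - t ∈ X ∧ q = parity n r + parity n s + parity n t := by
  obtain ⟨a, ha, b, hb, c, hc, hab, hac, hbc⟩ := Finset.two_lt_card.1 hq
  rw [mem_parityClass] at ha hb hc
  obtain ⟨r, hr, hr'⟩ := h.exists_mid (.inr hb.1) (.inr hc.1) hbc (by rw [hb.2, hc.2])
  obtain ⟨s, hs, hs'⟩ := h.exists_mid (.inr ha.1) (.inr hc.1) hac (by rw [ha.2, hc.2])
  obtain ⟨t, ht, ht'⟩ := h.exists_mid (.inr ha.1) (.inr hb.1) hab (by rw [ha.2, hb.2])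
  have e1 : s + t - r = a := by grind
  have e2 : r + t - s = b := by grind
  have e3 : r + s - t = c := by grind
  refine ⟨r, hr, s, hs, t, ht, by grind, by grind, by grind, e1 ▸ ha.1, e2 ▸ hb.1, e3 ▸ hc.1, ?_⟩
  have h1 : r + s + t = a + r + r := by grind
  rw [← map_add, ← map_add, h1, add_assoc, map_add, map_add, parity_add_self, ha.2, add_zero]

/-- Four points of one parity class have at least five midpoints. -/
lemma card_parityClass_le_three (h : MidpointsIn T X) (hT : T.card ≤ 4) (q : Fin n → ZMod 2) :
    (parityClass X q).card ≤ 3 := by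
  by_contra hq
  obtain ⟨a, ha⟩ : (parityClass X q).Nonempty := Finset.card_pos.1 (by omega)
  have h3 : 2 < ((parityClass X q).erase a).card := by
    rw [Finset.card_erase_of_mem ha]; omega
  obtain ⟨b, hb, c, hc, d, hd, hbc, hbd, hcd⟩ := Finset.two_lt_card.1 h3
  rw [Finset.mem_erase, mem_parityClass] at hb hc hd
  rw [mem_parityClass] at ha
  obtain ⟨hba, hb, hb'⟩ := hb
  obtain ⟨hca, hc, hc'⟩ := hc
  obtain ⟨hda, hd, hd'⟩ := hd
  obtain ⟨ha, ha'⟩ := ha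
  obtain ⟨ab, hab, eab⟩ := h.exists_mid (.inr ha) (.inr hb) hba.symm (by rw [ha', hb'])
  obtain ⟨ac, hac, eac⟩ := h.exists_mid (.inr ha) (.inr hc) hca.symm (by rw [ha', hc'])
  obtain ⟨ad, had, ead⟩ := h.exists_mid (.inr ha) (.inr hd) hda.symm (by rw [ha', hd'])
  obtain ⟨bc, hbc', ebc⟩ := h.exists_mid (.inr hb) (.inr hc) hbc (by rw [hb', hc'])
  obtain ⟨bd, hbd', ebd⟩ := h.exists_mid (.inr hb) (.inr hd) hbd (by rw [hb', hd'])
  obtain ⟨cd, hcd', ecd⟩ := h.exists_mid (.inr hc) (.inr hd) hcd (by rw [hc', hd'])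
  -- Only midpoints of complementary pairs can coincide, and only for one pair of pairs.
  have key : ∀ {p q r s t : Fin n → ℤ}, p ∈ T → q ∈ T → r ∈ T → s ∈ T → t ∈ T →
      [p, q, r, s, t].Nodup → False := by
    intro p q r s t hp hq hr hs ht hn
    have h5 : ([p, q, r, s, t].toFinset).card = 5 := by
      rw [List.toFinset_card_of_nodup hn]; rfl
    have : [p, q, r, s, t].toFinset ⊆ T := by
      intro z hz
      simp only [List.mem_toFinset, List.mem_cons, List.not_mem_nil, or_false] at hz
      rcases hz with rfl | rfl | rfl | rfl | rfl <;> assumption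
    have := Finset.card_le_card this
    omega
  have n1 : ab ≠ ac := by grind
  have n2 : ab ≠ ad := by grind
  have n3 : ab ≠ bc := by grind
  have n4 : ab ≠ bd := by grind
  have n5 : ac ≠ ad := by grind
  have n6 : ac ≠ bc := by grind
  have n7 : ac ≠ cd := by grind
  have n8 : ad ≠ bd := by grind
  have n9 : ad ≠ cd := by grind
  have n10 : bc ≠ bd := by grind
  have n11 : bc ≠ cd := by grind
  have n12 : bd ≠ cd := by grind
  by_cases e1 : ac = bd
  · refine key hab hcd' hac had hbc' ?_
    have : ab ≠ cd := by grind
    have : ad ≠ bc := by grind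
    simp; grind
  by_cases e2 : ad = bc
  · refine key hab hcd' had hac hbd' ?_
    have : ab ≠ cd := by grind
    simp; grind
  refine key hab hac had hbc' hbd' ?_
  simp; grind

lemma card_parityClass_le (h : MidpointsIn T X) (q : Fin n → ZMod 2) :
    (parityClass X q).card ≤ T.card + 1 := by
  obtain h0 | ⟨a, ha⟩ := (parityClass X q).eq_empty_or_nonempty
  · simp [h0]
  rw [mem_parityClass] at ha
  have hx : ∀ x ∈ (parityClass X q).erase a, ∃ c ∈ T, a + x = c + c := by
    intro x hx
    rw [Finset.mem_erase, mem_parityClass] at hx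
    exact h.exists_mid (.inr ha.1) (.inr hx.2.1) hx.1.symm (by rw [ha.2, hx.2.2])
  choose! f hf hf' using hx
  have := Finset.card_le_card_of_injOn f hf (by
    intro x hx y hy hxy
    have := hf' x hx
    have := hf' y hy
    grind)
  rw [Finset.card_erase_of_mem (mem_parityClass.2 ha)] at this
  omega

/-- The parity class of a point of `T` has fewer points of `X`, since the midpoints of these with
`t` are points of `T` other than `t`. -/
lemma card_parityClass_lt (h : MidpointsIn T X) {t : Fin n → ℤ} (ht : t ∈ T) :
    (parityClass X (parity n t)).card < T.card := by
  have hx : ∀ x ∈ parityClass X (parity n t), ∃ c ∈ T, t + x = c + c := by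
    intro x hx
    rw [mem_parityClass] at hx
    exact h.exists_mid (.inl ht) (.inr hx.1) (fun e => h.notMem x hx.1 (e ▸ ht)) hx.2.symm
  choose! f hf hf' using hx
  have := Finset.card_le_card_of_injOn (t := T.erase t) f (fun x hx => by
    refine Finset.mem_coe.2 (Finset.mem_erase.2 ⟨fun e => ?_, hf x hx⟩)
    have h1 := hf' x hx
    have h2 : x = t := by grind
    exact h.notMem x (mem_parityClass.1 hx).1 (h2 ▸ ht)) (by
    intro x hx y hy hxy
    have := hf' x hx
    have := hf' y hy
    grind)
  rw [Finset.card_erase_of_mem ht] at this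
  have := Finset.card_pos.2 ⟨t, ht⟩
  omega

lemma card_le_zero (h : MidpointsIn T X) (hT : T.card = 0) : X.card ≤ 2 ^ n := by
  rw [card_eq_sum_parityClass]
  calc _ ≤ ∑ _q : Fin n → ZMod 2, 1 :=
        Finset.sum_le_sum fun q _ => by have := h.card_parityClass_le q; omega
    _ = _ := by simp [ZMod.card]

lemma triangles_eq_zero (hτ : ∀ q, (parityClass X q).card < 3) :
    (Finset.univ.filter fun q => 3 ≤ (parityClass X q).card).card = 0 := by
  rw [Finset.card_eq_zero, Finset.filter_eq_empty_iff]
  intro q _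
  have := hτ q
  omega

lemma one_le_of_empty_class {q : Fin n → ZMod 2} (hq : (parityClass X q).card = 0) :
    1 ≤ (Finset.univ.filter fun q => (parityClass X q).card ≤ 1).card ∧
    1 ≤ (Finset.univ.filter fun q => (parityClass X q).card = 0).card :=
  ⟨Finset.card_pos.2 ⟨q, by simp only [Finset.mem_filter_univ]; omega⟩,
    Finset.card_pos.2 ⟨q, by simp only [Finset.mem_filter_univ]; omega⟩⟩

lemma card_le_one (h : MidpointsIn T X) (hT : T.card = 1) : X.card ≤ 2 ^ (n + 1) - 2 := by
  obtain ⟨t, ht⟩ := Finset.card_pos.1 (by omega : 0 < T.card)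
  have h1 := h.card_parityClass_lt ht
  have h2 : ∀ q, (parityClass X q).card < 3 := fun q => by
    have := h.card_parityClass_le q; omega
  have h3 := card_add_card_le (X := X) (fun q => (h2 q).le)
  rw [triangles_eq_zero h2] at h3
  have h4 := one_le_of_empty_class (X := X) (q := parity n t) (by omega)
  omega

lemma card_image_parity_le (hd : ∀ t ∈ T, (parityClass X (parity n t)).card ≤ 1) :
    (T.image (parity n)).card ≤
      (Finset.univ.filter fun q => (parityClass X q).card ≤ 1).card := by
  refine Finset.card_le_card fun q hq => ?_
  obtain ⟨t, ht, rfl⟩ := Finset.mem_image.1 hq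
  simpa using hd t ht

lemma card_le_two (h : MidpointsIn T X) (hT : T.card = 2) : X.card ≤ 2 ^ (n + 1) - 2 := by
  have h2 : ∀ q, (parityClass X q).card < 3 := by
    intro q
    by_contra hq
    obtain ⟨r, hr, s, hs, t, ht, hrs, hrt, hst, -⟩ := h.exists_triangle (not_lt.1 hq)
    have := Finset.two_lt_card.2 ⟨r, hr, s, hs, t, ht, hrs, hrt, hst⟩
    omega
  have h3 := card_add_card_le (X := X) (fun q => (h2 q).le)
  rw [triangles_eq_zero h2] at h3
  have h4 := card_image_parity_le (T := T) (X := X)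
    (fun t ht => by have := h.card_parityClass_lt ht; omega)
  rw [Finset.card_image_of_injOn] at h4
  · omega
  intro s hs t ht hst
  by_contra hne
  obtain ⟨c, hc, hc'⟩ := h.exists_mid (.inl hs) (.inl ht) hne hst
  have := Finset.two_lt_card.2 ⟨s, hs, t, ht, c, hc, hne, by grind, by grind⟩
  omega

/-- If the class of `t ∈ T` contains two points `x`, `y` of `X`, then either `t` is the midpoint
of `x` and `y`, so that `T` contains the midpoints of the intervals from `t` to `x` and `y`, or
`T` contains a parallelogram. -/
lemma collinear_or_parallelogram (h : MidpointsIn T X) {t : Fin n → ℤ} (ht : t ∈ T)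
    (h2 : 1 < (parityClass X (parity n t)).card) :
    (∃ m ∈ T, ∃ m' ∈ T, m ≠ m' ∧ m ≠ t ∧ m' ≠ t ∧ m + m' = t + t ∧ m + m - t ∈ X ∧
      m' + m' - t ∈ X) ∨
    ∃ m ∈ T, ∃ m' ∈ T, ∃ c ∈ T, m ≠ m' ∧ m ≠ t ∧ m' ≠ t ∧ c ≠ t ∧ c ≠ m ∧ c ≠ m' ∧
      m + m' = c + t := by
  obtain ⟨x, hx, y, hy, hxy⟩ := Finset.one_lt_card.1 h2
  rw [mem_parityClass] at hx hy
  have hxt : x ≠ t := fun e => h.notMem x hx.1 (e ▸ ht)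
  have hyt : y ≠ t := fun e => h.notMem y hy.1 (e ▸ ht)
  obtain ⟨m, hm, em⟩ := h.exists_mid (.inr hx.1) (.inl ht) hxt hx.2
  obtain ⟨m', hm', em'⟩ := h.exists_mid (.inr hy.1) (.inl ht) hyt hy.2
  obtain ⟨c, hc, ec⟩ := h.exists_mid (.inr hx.1) (.inr hy.1) hxy (by rw [hx.2, hy.2])
  have ex : m + m - t = x := by grind
  have ey : m' + m' - t = y := by grind
  by_cases hct : c = t
  · exact .inl ⟨m, hm, m', hm', by grind, by grind, by grind, by grind, ex ▸ hx.1, ey ▸ hy.1⟩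
  · exact .inr ⟨m, hm, m', hm', c, hc, by grind, by grind, by grind, hct, by grind, by grind,
      by grind⟩

/-- In the collinear case the class of `m` contains no point of `X`. -/
lemma card_parityClass_eq_zero (h : MidpointsIn T X) {m t m' v : Fin n → ℤ} (hm : m ∈ T)
    (hm' : m' ∈ T) (ht : t ∈ T) (hmm : m ≠ m') (hmt : m + m' = t + t) (hx : m + m - t ∈ X)
    (hy : m' + m' - t ∈ X) (hT : ∀ z ∈ T, z = m ∨ z = t ∨ z = m' ∨ z = v) :
    (parityClass X (parity n m)).card = 0 := by
  rw [Finset.card_eq_zero, Finset.eq_empty_iff_forall_notMem]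
  intro y hyq
  rw [mem_parityClass] at hyq
  obtain ⟨hyX, hyp⟩ := hyq
  have hym : y ≠ m := fun e => h.notMem y hyX (e ▸ hm)
  have hym' : y ≠ m' := fun e => h.notMem y hyX (e ▸ hm')
  have hyt : y ≠ t := fun e => h.notMem y hyX (e ▸ ht)
  obtain ⟨c, hc, ec⟩ := h.exists_mid (.inr hyX) (.inl hm) hym hyp
  obtain ⟨d, hd, ed⟩ := h.exists_mid (.inr hyX) (.inl hm') hym'
    (hyp.trans (parity_eq_of_midpoint hmt))
  have hcx : c ≠ m + m - t := fun e => h.notMem _ hx (e ▸ hc)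
  have hdy : d ≠ m' + m' - t := fun e => h.notMem _ hy (e ▸ hd)
  have hcd : c - d + m' = t := by grind
  rcases hT c hc with rfl | rfl | rfl | rfl <;> rcases hT d hd with rfl | rfl | rfl | rfl <;> grind

/-- A set of four points with a nondegenerate triangle as in `exists_triangle` is not a
parallelogram: the fourth vertex would be one of `s + t - r`, `r + t - s`, `r + s - t`. -/
lemma card_parityClass_lt_of_parallelogram (h : MidpointsIn T X) (hT : T.card ≤ 4)
    {m m' c t : Fin n → ℤ} (hm : m ∈ T) (hm' : m' ∈ T) (hc : c ∈ T) (ht : t ∈ T) (h1 : m ≠ m')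
    (h2 : m ≠ t) (h3 : m' ≠ t) (h4 : c ≠ t) (h5 : c ≠ m) (h6 : c ≠ m') (h7 : m + m' = c + t)
    (q : Fin n → ZMod 2) : (parityClass X q).card < 3 := by
  by_contra hq
  obtain ⟨r, hr, s, hs, u, hu, hrs, hru, hsu, x1, x2, x3, -⟩ := h.exists_triangle (not_lt.1 hq)
  have hTeq : ({m, m', c, t} : Finset (Fin n → ℤ)) = T := by
    refine Finset.eq_of_subset_of_card_le ?_ ?_
    · intro z hz
      simp only [Finset.mem_insert, Finset.mem_singleton] at hz
      rcases hz with rfl | rfl | rfl | rfl <;> assumption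
    · rw [Finset.card_insert_of_notMem, Finset.card_insert_of_notMem, Finset.card_pair h4]
      · exact hT
      · simp; grind
      · simp; grind
  have hmem : ∀ z ∈ T, z = m ∨ z = m' ∨ z = c ∨ z = t := by
    intro z hz
    simpa [← hTeq] using hz
  have y1 : ∀ z ∈ T, s + u ≠ r + z := fun z hz e =>
    h.notMem _ x1 (by rwa [show s + u - r = z by grind])
  have y2 : ∀ z ∈ T, r + u ≠ s + z := fun z hz e =>
    h.notMem _ x2 (by rwa [show r + u - s = z by grind])
  have y3 : ∀ z ∈ T, r + s ≠ u + z := fun z hz e =>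
    h.notMem _ x3 (by rwa [show r + s - u = z by grind])
  have e1 : m' + m = c + t := by rw [add_comm, h7]
  have e2 : m + m' = t + c := by rw [h7, add_comm]
  have e3 : m' + m = t + c := by rw [e1, add_comm]
  have e4 := h7.symm
  have e5 := e1.symm
  have e6 := e2.symm
  have e7 := e3.symm
  have y1m := y1 m hm; have y1m' := y1 m' hm'; have y1c := y1 c hc; have y1t := y1 t ht
  have y2m := y2 m hm; have y2m' := y2 m' hm'; have y2c := y2 c hc; have y2t := y2 t ht
  have y3m := y3 m hm; have y3m' := y3 m' hm'; have y3c := y3 c hc; have y3t := y3 t ht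
  clear y1 y2 y3 x1 x2 x3
  have hu' := hmem u hu
  rcases hmem r hr with rfl | rfl | rfl | rfl <;> rcases hmem s hs with rfl | rfl | rfl | rfl <;>
    first
    | contradiction
    | (rcases hu' with rfl | rfl | rfl | rfl <;> contradiction)

/-- Three points of `T` in arithmetic progression are not the midpoints of a three-point class. -/
lemma add_ne_add_self_of_triangle (h : MidpointsIn T X) {r s t : Fin n → ℤ}
    (ht : t ∈ T) (hx : r + s - t ∈ X) : r + s ≠ t + t := fun e =>
  h.notMem _ hx (by rwa [show r + s - t = t by grind])

lemma card_le_three (h : MidpointsIn T X) (hT : T.card = 3) : X.card ≤ 2 ^ (n + 1) - 2 := by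
  have h3 := card_add_card_le (X := X) (h.card_parityClass_le_three (by omega))
  -- All three-point classes are the class of the sum of the three points of `T`.
  have hτ : (Finset.univ.filter fun q => 3 ≤ (parityClass X q).card).card ≤ 1 := by
    refine Finset.card_le_one.2 fun q hq q' hq' => ?_
    have key : ∀ q, 3 ≤ (parityClass X q).card → q = ∑ t ∈ T, parity n t := by
      intro q hq
      obtain ⟨r, hr, s, hs, u, hu, hrs, hru, hsu, -, -, -, e⟩ := h.exists_triangle hq
      have hTeq : ({r, s, u} : Finset (Fin n → ℤ)) = T := by
        refine Finset.eq_of_subset_of_card_le ?_ ?_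
        · intro z hz
          simp only [Finset.mem_insert, Finset.mem_singleton] at hz
          rcases hz with rfl | rfl | rfl <;> assumption
        · rw [Finset.card_insert_of_notMem (by simp; grind), Finset.card_pair hsu]
          exact hT.le
      rw [← hTeq, Finset.sum_insert (by simp; grind), Finset.sum_pair hsu, e, add_assoc]
    rw [key q (by simpa using hq), key q' (by simpa using hq')]
  -- An arithmetic progression in `T` excludes three-point classes.
  have hprog : ∀ a ∈ T, ∀ b ∈ T, ∀ c ∈ T, a ≠ b → a + b = c + c →
      (∀ z ∈ T, z = a ∨ z = c ∨ z = b) ∧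
      (Finset.univ.filter fun q => 3 ≤ (parityClass X q).card).card = 0 := by
    intro a ha b hb c hc hab e
    have hTeq : ({a, c, b} : Finset (Fin n → ℤ)) = T := by
      refine Finset.eq_of_subset_of_card_le ?_ ?_
      · intro z hz
        simp only [Finset.mem_insert, Finset.mem_singleton] at hz
        rcases hz with rfl | rfl | rfl <;> assumption
      · rw [Finset.card_insert_of_notMem (by simp; grind), Finset.card_pair (by grind)]
        exact hT.le
    have hmem : ∀ z ∈ T, z = a ∨ z = c ∨ z = b := by
      intro z hz
      simpa [← hTeq] using hz
    refine ⟨hmem, triangles_eq_zero fun q => ?_⟩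
    by_contra hq
    obtain ⟨r, hr, s, hs, u, hu, hrs, hru, hsu, x1, x2, x3, -⟩ := h.exists_triangle (not_lt.1 hq)
    have y1 := h.add_ne_add_self_of_triangle hr x1
    have y2 := h.add_ne_add_self_of_triangle hs x2
    have y3 := h.add_ne_add_self_of_triangle hu x3
    have hcomm := add_comm a b
    rcases hmem r hr with rfl | rfl | rfl <;> rcases hmem s hs with rfl | rfl | rfl <;>
      rcases hmem u hu with rfl | rfl | rfl <;> first | contradiction | grind
  by_cases hd : ∀ t ∈ T, (parityClass X (parity n t)).card ≤ 1
  · have h4 := card_image_parity_le hd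
    by_cases hinj : Set.InjOn (parity n) (T : Set (Fin n → ℤ))
    · rw [Finset.card_image_of_injOn hinj] at h4
      omega
    -- Two points of equal parity have the third one as midpoint, whose parity is different.
    obtain ⟨a, ha, b, hb, hp, hab⟩ : ∃ a ∈ T, ∃ b ∈ T, parity n a = parity n b ∧ a ≠ b := by
      simpa [Set.InjOn] using hinj
    obtain ⟨c, hc, e⟩ := h.exists_mid (.inl ha) (.inl hb) hab hp
    obtain ⟨hmem, h5⟩ := hprog a ha b hb c hc hab e
    have hpc : parity n a ≠ parity n c := by
      intro hpc
      obtain ⟨d, hd, ed⟩ := h.exists_mid (.inl ha) (.inl hc) (by grind) hpc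
      rcases hmem d hd with rfl | rfl | rfl <;> grind
    have h6 : 1 < (T.image (parity n)).card :=
      Finset.one_lt_card.2 ⟨_, Finset.mem_image_of_mem _ ha, _, Finset.mem_image_of_mem _ hc, hpc⟩
    omega
  · push Not at hd
    obtain ⟨t, ht, h2⟩ := hd
    rcases h.collinear_or_parallelogram ht h2 with
      ⟨m, hm, m', hm', n1, n2, n3, e, x1, x2⟩ | ⟨m, hm, m', hm', c, hc, n1, n2, n3, n4, n5, n6, e⟩
    · obtain ⟨hmem, h5⟩ := hprog m hm m' hm' t ht n1 e
      have h6 := one_le_of_empty_class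
        (h.card_parityClass_eq_zero (v := t) hm hm' ht n1 e x1 x2 (by grind))
      omega
    · have h6 : ({m, m', c, t} : Finset (Fin n → ℤ)) ⊆ T := by
        intro z hz
        simp only [Finset.mem_insert, Finset.mem_singleton] at hz
        rcases hz with rfl | rfl | rfl | rfl <;> assumption
      have h7 := Finset.card_le_card h6
      rw [Finset.card_insert_of_notMem (by simp; grind),
        Finset.card_insert_of_notMem (by simp; grind), Finset.card_pair n4] at h7
      omega

lemma card_le_four (h : MidpointsIn T X) (hT : T.card = 4) : X.card ≤ 2 ^ (n + 1) := by
  have h3 := card_add_card_le (X := X) (h.card_parityClass_le_three (by omega))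
  -- A three-point class is determined by the point of `T` that is not one of its midpoints.
  have key : ∀ q, 3 ≤ (parityClass X q).card → ∃ r ∈ T, ∃ s ∈ T, ∃ u ∈ T, ∃ v ∈ T,
      (∀ z ∈ T, z = r ∨ z = s ∨ z = u ∨ z = v) ∧ r + s ≠ u + u ∧ r + u ≠ s + s ∧
      s + u ≠ r + r ∧ (∑ t ∈ T, parity n t) - parity n v = q := by
    intro q hq
    obtain ⟨r, hr, s, hs, u, hu, hrs, hru, hsu, x1, x2, x3, e⟩ := h.exists_triangle hq
    have hsub : ({r, s, u} : Finset (Fin n → ℤ)) ⊆ T := by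
      intro z hz
      simp only [Finset.mem_insert, Finset.mem_singleton] at hz
      rcases hz with rfl | rfl | rfl <;> assumption
    have hcard : ({r, s, u} : Finset (Fin n → ℤ)).card = 3 := by
      rw [Finset.card_insert_of_notMem (by simp; grind), Finset.card_pair hsu]
    obtain ⟨v, hv⟩ : ∃ v, T \ {r, s, u} = {v} := by
      rw [← Finset.card_eq_one, Finset.card_sdiff_of_subset hsub]
      omega
    have hvT : v ∈ T ∧ v ∉ ({r, s, u} : Finset (Fin n → ℤ)) := by
      rw [← Finset.mem_sdiff, hv, Finset.mem_singleton]
    refine ⟨r, hr, s, hs, u, hu, v, hvT.1, ?_, h.add_ne_add_self_of_triangle hu x3,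
      h.add_ne_add_self_of_triangle hs x2, h.add_ne_add_self_of_triangle hr x1, ?_⟩
    · intro z hz
      by_cases hz' : z ∈ ({r, s, u} : Finset (Fin n → ℤ))
      · simp only [Finset.mem_insert, Finset.mem_singleton] at hz'
        tauto
      · have : z ∈ T \ {r, s, u} := Finset.mem_sdiff.2 ⟨hz, hz'⟩
        rw [hv, Finset.mem_singleton] at this
        tauto
    · rw [← Finset.sum_sdiff hsub, hv, Finset.sum_singleton,
        Finset.sum_insert (by simp; grind), Finset.sum_pair hsu, e]
      abel
  by_cases hd : ∀ t ∈ T, (parityClass X (parity n t)).card ≤ 1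
  · have h4 := card_image_parity_le hd
    have h5 : (Finset.univ.filter fun q => 3 ≤ (parityClass X q).card).card ≤
        (T.image (parity n)).card := by
      refine (Finset.card_le_card (t := (T.image (parity n)).image
        fun p => (∑ t ∈ T, parity n t) - p) fun q hq => ?_).trans Finset.card_image_le
      obtain ⟨-, -, -, -, -, -, v, hv, -, -, -, -, e⟩ := key q (by simpa using hq)
      exact Finset.mem_image.2 ⟨_, Finset.mem_image_of_mem _ hv, e⟩
    omega
  · push Not at hd
    obtain ⟨t, ht, h2⟩ := hd
    rcases h.collinear_or_parallelogram ht h2 with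
      ⟨m, hm, m', hm', n1, n2, n3, e, x1, x2⟩ | ⟨m, hm, m', hm', c, hc, n1, n2, n3, n4, n5, n6, e⟩
    · have hsub : ({m, t, m'} : Finset (Fin n → ℤ)) ⊆ T := by
        intro z hz
        simp only [Finset.mem_insert, Finset.mem_singleton] at hz
        rcases hz with rfl | rfl | rfl <;> assumption
      have hcard : ({m, t, m'} : Finset (Fin n → ℤ)).card = 3 := by
        rw [Finset.card_insert_of_notMem (by simp; grind), Finset.card_pair n3.symm]
      obtain ⟨v, hv⟩ : ∃ v, T \ {m, t, m'} = {v} := by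
        rw [← Finset.card_eq_one, Finset.card_sdiff_of_subset hsub]
        omega
      have hmem : ∀ z ∈ T, z = m ∨ z = t ∨ z = m' ∨ z = v := by
        intro z hz
        by_cases hz' : z ∈ ({m, t, m'} : Finset (Fin n → ℤ))
        · simp only [Finset.mem_insert, Finset.mem_singleton] at hz'
          tauto
        · have : z ∈ T \ {m, t, m'} := Finset.mem_sdiff.2 ⟨hz, hz'⟩
          rw [hv, Finset.mem_singleton] at this
          tauto
      have h6 := one_le_of_empty_class (h.card_parityClass_eq_zero hm hm' ht n1 e x1 x2 hmem)
      -- The point omitted by a three-point class is `m`, `m'` or `t`, and `m`, `m'` have equal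
      -- parity.
      have h5 : (Finset.univ.filter fun q => 3 ≤ (parityClass X q).card).card ≤ 2 := by
        refine (Finset.card_le_card (t := ({m, t} : Finset (Fin n → ℤ)).image
          fun z => (∑ t ∈ T, parity n t) - parity n z) fun q hq => ?_).trans
          (Finset.card_image_le.trans Finset.card_le_two)
        obtain ⟨r, hr, s, hs, u, hu, w, hw, hmem', y1, y2, y3, e'⟩ := key q (by simpa using hq)
        have hwv : w = m ∨ w = t ∨ w = m' := by
          by_contra hw'
          have hm2 := hmem' m hm
          have hm3 := hmem' m' hm'
          have ht2 := hmem' t ht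
          have hcomm := add_comm m m'
          have hmw : m ≠ w := fun e => hw' (.inl e.symm)
          have htw : t ≠ w := fun e => hw' (.inr (.inl e.symm))
          have hmw' : m' ≠ w := fun e => hw' (.inr (.inr e.symm))
          clear hw' hmem hmem' key h3
          rcases hm2 with rfl | rfl | rfl | rfl <;> rcases hm3 with rfl | rfl | rfl | rfl <;>
            first
            | contradiction
            | (rcases ht2 with rfl | rfl | rfl | rfl <;> first | contradiction | grind)
        rcases hwv with rfl | rfl | rfl
        · exact Finset.mem_image.2 ⟨_, by simp, e'⟩
        · exact Finset.mem_image.2 ⟨_, by simp, e'⟩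
        · refine Finset.mem_image.2 ⟨m, by simp, ?_⟩
          rw [parity_eq_of_midpoint e, e']
      omega
    · rw [triangles_eq_zero (h.card_parityClass_lt_of_parallelogram hT.le hm hm' hc ht n1 n2 n3 n4
        n5 n6 e)] at h3
      omega

end MidpointsIn

/-! ### From convex sets to midpoint-closed configurations -/

/-- The real vector with the coordinates of a lattice vector. -/
def latticePoint {n : ℕ} (z : Fin n → ℤ) : Fin n → ℝ := fun i => (z i : ℝ)

lemma latticePoint_injective {n : ℕ} : Function.Injective (latticePoint (n := n)) := by
  intro y z h
  ext i
  exact Int.cast_injective (congrFun h i)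

lemma latticePoint_add {n : ℕ} (y z : Fin n → ℤ) :
    latticePoint (y + z) = latticePoint y + latticePoint z := by
  ext i
  simp [latticePoint]

lemma encard_intLattice_inter {n : ℕ} (C : Set (Fin n → ℝ)) :
    (intLattice n ∩ C).encard = (latticePoint ⁻¹' C).encard := by
  rw [← latticePoint_injective.encard_image, Set.image_preimage_eq_range_inter]
  rfl

/-- Open half-spaces `{f i < β i}` of which none can be dropped without changing the set `T` of
points of `A` they have in common can be enlarged, keeping `T`, so that each has a point of `A` on
its boundary that lies in all the others. -/
lemma exists_boundary_points {α ι : Type*} [Fintype ι] {A T : Finset α} {f : ι → α → ℝ}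
    {β : ι → ℝ} (hT : ∀ a ∈ A, (∀ i, f i a < β i) → a ∈ T) (hT' : ∀ a ∈ T, ∀ i, f i a < β i)
    (hirr : ∀ i, ∃ a ∈ A, β i ≤ f i a ∧ ∀ j, j ≠ i → f j a < β j) :
    ∃ x : ι → α, (∀ i, x i ∈ A) ∧ (∀ i j, j ≠ i → f j (x i) < f j (x j)) ∧
      (∀ a ∈ A, (∀ i, f i a < f i (x i)) → a ∈ T) ∧ ∀ a ∈ T, ∀ i, f i a < f i (x i) := by
  classical
  let F := (Fintype.piFinset fun _ : ι => A).filter fun x =>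
    (∀ i, β i ≤ f i (x i)) ∧ ∀ a ∈ A, (∀ i, f i a < f i (x i)) → a ∈ T
  have hF : ∀ x, x ∈ F ↔ (∀ i, x i ∈ A) ∧ (∀ i, β i ≤ f i (x i)) ∧
      ∀ a ∈ A, (∀ i, f i a < f i (x i)) → a ∈ T := by
    intro x
    simp [F]
  have hne : F.Nonempty := by
    have h1 : ∀ i, ∃ x ∈ A, β i ≤ f i x ∧ ∀ a ∈ A, β i ≤ f i a → f i x ≤ f i a := by
      intro i
      obtain ⟨a, ha, hai, -⟩ := hirr i
      obtain ⟨x, hx, hmin⟩ := Finset.exists_min_image (A.filter fun a => β i ≤ f i a) (f i)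
        ⟨a, Finset.mem_filter.2 ⟨ha, hai⟩⟩
      rw [Finset.mem_filter] at hx
      exact ⟨x, hx.1, hx.2, fun a ha hai => hmin a (Finset.mem_filter.2 ⟨ha, hai⟩)⟩
    choose x hxA hxβ hx using h1
    refine ⟨x, (hF x).2 ⟨hxA, hxβ, fun a ha h => hT a ha fun i => ?_⟩⟩
    by_contra hc
    exact absurd (hx i a ha (not_lt.1 hc)) (not_le.2 (h i))
  -- The sum of the levels is maximal when no half-space can be enlarged further.
  obtain ⟨x, hx, hmax⟩ := Finset.exists_max_image F (fun x => ∑ i, f i (x i)) hne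
  obtain ⟨hxA, hxβ, hxT⟩ := (hF x).1 hx
  have key : ∀ i, ∃ z ∈ A, f i z = f i (x i) ∧ ∀ j, j ≠ i → f j z < f j (x j) := by
    intro i
    obtain ⟨a, ha, hai, haj⟩ := hirr i
    have haj' : ∀ j, j ≠ i → f j a < f j (x j) := fun j hj => (haj j hj).trans_le (hxβ j)
    have hai' : f i (x i) ≤ f i a := by
      by_contra hc
      have haT : a ∈ T := hxT a ha fun j => by
        by_cases hj : j = i
        · exact hj ▸ not_le.1 hc
        · exact haj' j hj
      exact absurd (hT' a haT i) (not_lt.2 hai)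
    obtain ⟨z, hz, hmin⟩ := Finset.exists_min_image
      (A.filter fun a => f i (x i) ≤ f i a ∧ ∀ j, j ≠ i → f j a < f j (x j)) (f i)
      ⟨a, Finset.mem_filter.2 ⟨ha, hai', haj'⟩⟩
    obtain ⟨hzA, hzi, hzj⟩ := Finset.mem_filter.1 hz
    have hup : Function.update x i z ∈ F := by
      refine (hF _).2 ⟨fun j => ?_, fun j => ?_, fun b hb hbj => ?_⟩
      · by_cases hj : j = i
        · subst hj; simpa using hzA
        · simpa [hj] using hxA j
      · by_cases hj : j = i
        · subst hj; simpa using (hxβ j).trans hzi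
        · simpa [hj] using hxβ j
      · have hbj' : ∀ j, j ≠ i → f j b < f j (x j) := fun j hj => by simpa [hj] using hbj j
        have hbi : f i b < f i z := by simpa using hbj i
        refine hxT b hb fun j => ?_
        by_cases hj : j = i
        · subst hj
          by_contra hc
          exact absurd (hmin b (Finset.mem_filter.2 ⟨hb, not_lt.1 hc, hbj'⟩)) (not_le.2 hbi)
        · exact hbj' j hj
    have hsum := hmax _ hup
    rw [← Finset.add_sum_erase _ _ (Finset.mem_univ i),
      ← Finset.add_sum_erase (a := i) _ (fun j => f j (x j)) (Finset.mem_univ i),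
      Finset.sum_congr (g := fun j => f j (x j)) rfl (fun j hj => by
        rw [Function.update_of_ne (Finset.ne_of_mem_erase hj)])] at hsum
    simp only [Function.update_self, add_le_add_iff_right] at hsum
    exact ⟨z, hzA, le_antisymm hsum hzi, hzj⟩
  choose z hzA hz hzj using key
  refine ⟨z, hzA, fun i j hj => ?_, fun a ha h => hxT a ha fun i => hz i ▸ h i,
    fun a ha i => (hT' a ha i).trans_le ((hxβ i).trans (hz i).ge)⟩
  rw [hz j]
  exact hzj i j hj

/-- A point outside a convex set can be separated from any finite part of it. -/
lemma exists_separating {n : ℕ} (A : Finset (Fin n → ℤ)) {C : Set (Fin n → ℝ)}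
    (hC : Convex ℝ C) {a : Fin n → ℤ} (ha : latticePoint a ∉ C) :
    ∃ (f : (Fin n → ℝ) →L[ℝ] ℝ) (u : ℝ),
      (∀ b ∈ A, latticePoint b ∈ C → f (latticePoint b) < u) ∧ u ≤ f (latticePoint a) := by
  have hfin : (C ∩ latticePoint '' (A : Set (Fin n → ℤ))).Finite :=
    (A.finite_toSet.image _).subset Set.inter_subset_right
  obtain ⟨f, u, h1, h2⟩ := geometric_hahn_banach_closed_point (convex_convexHull ℝ _)
    (hfin.isClosed_convexHull ℝ)
    (fun h => ha (convexHull_min Set.inter_subset_left hC h))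
  exact ⟨f, u, fun b hb hbC => h1 _ (subset_convexHull ℝ _ ⟨hbC, Set.mem_image_of_mem _ hb⟩),
    h2.le⟩

/-- The boundary points of half-spaces as in `exists_boundary_points`, taken in a box of lattice
points, have all their midpoints in `T`. -/
lemma midpointsIn_of_halfspaces {n : ℕ} {ι : Type*} [Fintype ι] {lo hi : Fin n → ℤ}
    {T X : Finset (Fin n → ℤ)} {f : ι → (Fin n → ℝ) →L[ℝ] ℝ} {x : ι → Fin n → ℤ}
    (hX : ∀ z, z ∈ X ↔ ∃ i, x i = z)
    (hTA : T ⊆ Finset.Icc lo hi) (hxA : ∀ i, x i ∈ Finset.Icc lo hi)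
    (hx : ∀ i j, j ≠ i → f j (latticePoint (x i)) < f j (latticePoint (x j)))
    (hT : ∀ a ∈ Finset.Icc lo hi, (∀ i, f i (latticePoint a) < f i (latticePoint (x i))) → a ∈ T)
    (hT' : ∀ a ∈ T, ∀ i, f i (latticePoint a) < f i (latticePoint (x i))) :
    MidpointsIn T X := by
  have hA : ∀ a ∈ T ∪ X, a ∈ Finset.Icc lo hi := by
    intro a ha
    rcases Finset.mem_union.1 ha with h | h
    · exact hTA h
    · obtain ⟨i, rfl⟩ := (hX a).1 h
      exact hxA i
  have hle : ∀ a ∈ T ∪ X, ∀ i,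
      f i (latticePoint a) < f i (latticePoint (x i)) ∨ a = x i := by
    intro a ha i
    rcases Finset.mem_union.1 ha with h | h
    · exact .inl (hT' a h i)
    · obtain ⟨j, rfl⟩ := (hX a).1 h
      by_cases hij : i = j
      · exact .inr (by rw [hij])
      · exact .inl (hx j i hij)
  constructor
  · intro a ha haT
    obtain ⟨i, rfl⟩ := (hX a).1 ha
    exact lt_irrefl _ (hT' _ haT i)
  · intro a ha b hb hab c hc
    refine hT c ?_ fun i => ?_
    · have h1 := Finset.mem_Icc.1 (hA a ha)
      have h2 := Finset.mem_Icc.1 (hA b hb)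
      rw [Finset.mem_Icc]
      refine ⟨fun l => ?_, fun l => ?_⟩
      · have h3 : a l + b l = c l + c l := congrFun hc l
        have h4 : lo l ≤ a l := h1.1 l
        have h5 : lo l ≤ b l := h2.1 l
        change lo l ≤ c l
        omega
      · have h3 : a l + b l = c l + c l := congrFun hc l
        have h4 : a l ≤ hi l := h1.2 l
        have h5 : b l ≤ hi l := h2.2 l
        change c l ≤ hi l
        omega
    · have h3 : f i (latticePoint a) + f i (latticePoint b) =
          f i (latticePoint c) + f i (latticePoint c) := by
        rw [← map_add, ← map_add, ← latticePoint_add, ← latticePoint_add, hc]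
      rcases hle a ha i with h1 | h1 <;> rcases hle b hb i with h2 | h2
      · linarith
      · rw [← h2]; rw [← h2] at h1; linarith
      · rw [← h1]; rw [← h1] at h2; linarith
      · exact absurd (h1.trans h2.symm) hab

/-- An upper bound on the size of midpoint-closed configurations is a quantitative Helly bound. -/
theorem isQuantHellyBound_of_midpointsIn {n k b : ℕ}
    (hb : ∀ T X : Finset (Fin n → ℤ), MidpointsIn T X → T.card = k → X.card ≤ b) :
    IsQuantHellyBound (intLattice n) k b := by
  classical
  intro m C _ hC hk
  simp only [encard_intLattice_inter] at hk ⊢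
  obtain ⟨T, hTS, hTk⟩ : ∃ T : Finset (Fin n → ℤ), (∀ z, z ∈ T ↔ ∀ i, latticePoint z ∈ C i) ∧
      T.card = k := by
    have hfin := Set.finite_of_encard_eq_coe hk
    refine ⟨hfin.toFinset, fun z => by simp, ?_⟩
    rw [hfin.encard_eq_coe_toFinset_card] at hk
    exact_mod_cast hk
  -- A subfamily of least size with the same lattice points.
  let G := (Finset.univ : Finset (Finset (Fin m))).filter fun I =>
    ∀ z, (∀ i ∈ I, latticePoint z ∈ C i) → z ∈ T
  obtain ⟨I, hI, hmin⟩ := Finset.exists_min_image G Finset.card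
    ⟨Finset.univ, by simp [G, hTS]⟩
  simp only [G, Finset.mem_filter_univ] at hI hmin
  refine ⟨I, ?_, ?_⟩
  swap
  · have : latticePoint ⁻¹' (⋂ i ∈ I, C i) = (T : Set (Fin n → ℤ)) := by
      ext z
      simp only [Set.mem_preimage, Set.mem_iInter, Finset.mem_coe]
      exact ⟨hI z, fun h i _ => (hTS z).1 h i⟩
    rw [this, Set.encard_coe_eq_coe_finsetCard, hTk]
  have hx : ∀ i ∈ I, ∃ x, x ∉ T ∧ ∀ j ∈ I, j ≠ i → latticePoint x ∈ C j := by
    intro i hi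
    by_contra! hcon
    have := hmin (I.erase i) fun z hz => by
      by_contra hzT
      obtain ⟨j, hj, hji, hjz⟩ := hcon z hzT
      exact hjz (hz j (Finset.mem_erase.2 ⟨hji, hj⟩))
    have := Finset.card_erase_lt_of_mem hi
    omega
  choose! x hxT hxC using hx
  obtain ⟨lo, hlo⟩ := (T ∪ I.image x).finite_toSet.bddBelow
  obtain ⟨hi, hhi⟩ := (T ∪ I.image x).finite_toSet.bddAbove
  set A := Finset.Icc lo hi with hA
  have hsub : ∀ z ∈ T ∪ I.image x, z ∈ A := fun z hz => Finset.mem_Icc.2 ⟨hlo hz, hhi hz⟩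
  have hTA : T ⊆ A := fun z hz => hsub z (Finset.mem_union_left _ hz)
  have hxA : ∀ i ∈ I, x i ∈ A := fun i hi =>
    hsub _ (Finset.mem_union_right _ (Finset.mem_image_of_mem _ hi))
  -- Inside `A`, each convex set is replaced by half-spaces excluding its missing points.
  have hsep : ∀ p : Fin m × (Fin n → ℤ), ∃ (f : (Fin n → ℝ) →L[ℝ] ℝ) (u : ℝ),
      latticePoint p.2 ∉ C p.1 →
        (∀ b ∈ A, latticePoint b ∈ C p.1 → f (latticePoint b) < u) ∧
          u ≤ f (latticePoint p.2) := by
    intro p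
    by_cases hp : latticePoint p.2 ∈ C p.1
    · exact ⟨0, 0, fun h => absurd hp h⟩
    · obtain ⟨f, u, h⟩ := exists_separating A (hC p.1) hp
      exact ⟨f, u, fun _ => h⟩
  choose f u hfu using hsep
  let P := (I ×ˢ A).filter fun p => latticePoint p.2 ∉ C p.1
  have hP : ∀ p, p ∈ P ↔ (p.1 ∈ I ∧ p.2 ∈ A) ∧ latticePoint p.2 ∉ C p.1 := by
    intro p
    simp [P]
  obtain ⟨J, hJ, hJmin⟩ := Finset.exists_min_image
    (P.powerset.filter fun J => ∀ a ∈ A, (∀ p ∈ J, f p (latticePoint a) < u p) → a ∈ T)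
    Finset.card ⟨P, by
      simp only [Finset.mem_filter, Finset.mem_powerset, Finset.Subset.refl, true_and]
      intro a ha haP
      refine hI a fun i hi => ?_
      by_contra hc
      exact absurd (haP (i, a) ((hP _).2 ⟨⟨hi, ha⟩, hc⟩)) (not_lt.2 (hfu (i, a) hc).2)⟩
  simp only [Finset.mem_filter, Finset.mem_powerset, and_imp] at hJ hJmin
  obtain ⟨hJP, hJT⟩ := hJ
  have hJT' : ∀ a ∈ T, ∀ p ∈ J, f p (latticePoint a) < u p := fun a ha p hp =>
    (hfu p ((hP p).1 (hJP hp)).2).1 a (hTA ha) ((hTS a).1 ha p.1)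
  -- Every convex set of the minimal subfamily contributes a half-space.
  have hIJ : I.card ≤ J.card := by
    refine (Finset.card_le_card (t := J.image Prod.fst) fun i hi => ?_).trans Finset.card_image_le
    by_contra hc
    refine hxT i hi (hJT _ (hxA i hi) fun p hp => ?_)
    have hp' := (hP p).1 (hJP hp)
    refine (hfu p hp'.2).1 _ (hxA i hi) (hxC i hi _ hp'.1.1 fun e => hc ?_)
    exact Finset.mem_image.2 ⟨p, hp, e⟩
  have hirr : ∀ p : J, ∃ a ∈ A, u p ≤ f p (latticePoint a) ∧
      ∀ q : J, q ≠ p → f q (latticePoint a) < u q := by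
    intro p
    by_contra! hcon
    have := hJmin (J.erase p) ((Finset.erase_subset _ _).trans hJP) fun a ha h => by
      by_cases hap : u p ≤ f p (latticePoint a)
      · obtain ⟨q, hqp, hq⟩ := hcon a ha hap
        exact absurd (h q (Finset.mem_erase.2 ⟨fun e => hqp (Subtype.ext e), q.2⟩)) (not_lt.2 hq)
      · refine hJT a ha fun q hq => ?_
        by_cases hqp : q = p
        · exact hqp ▸ not_le.1 hap
        · exact h q (Finset.mem_erase.2 ⟨hqp, hq⟩)
    have := Finset.card_erase_lt_of_mem p.2
    omega
  obtain ⟨y, hyA, hy, hyT, hyT'⟩ := exists_boundary_points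
    (f := fun (p : J) a => f p (latticePoint a)) (β := fun p : J => u p)
    (fun a ha h => hJT a ha fun p hp => h ⟨p, hp⟩) (fun a ha p => hJT' a ha p p.2) hirr
  have hinj : Function.Injective y := by
    intro p q hpq
    by_contra hne
    have := hy p q (Ne.symm hne)
    rw [hpq] at this
    exact lt_irrefl _ this
  have hmid := midpointsIn_of_halfspaces (X := Finset.univ.image y) (f := fun p : J => f p)
    (fun z => by simp) hTA hyA hy hyT hyT'
  have := hb T _ hmid hTk
  rw [Finset.card_image_of_injective _ hinj, Finset.card_univ, Fintype.card_coe] at this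
  omega

/-! ### Lower bounds from extreme lattice points -/

/-- The number of extreme lattice points of a convex set with `k` further lattice points is a lower
bound for the quantitative Helly number: the sets obtained by removing one extreme point each
form a family in which no member can be dropped. -/
theorem quantHelly_eq_of_extremePoints {n k b : ℕ}
    (hup : ∀ T X : Finset (Fin n → ℤ), MidpointsIn T X → T.card = k → X.card ≤ b)
    {P : Set (Fin n → ℝ)} (hP : Convex ℝ P) {T X : Finset (Fin n → ℤ)}
    (hTX : ∀ z, latticePoint z ∈ P ↔ z ∈ T ∨ z ∈ X) (hdisj : ∀ x ∈ X, x ∉ T)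
    (hext : ∀ x ∈ X, latticePoint x ∈ P.extremePoints ℝ) (hT : T.card = k) (hX : b ≤ X.card) :
    quantHelly (intLattice n) k = ((b : ℕ∞) : WithBot ℕ∞) := by
  classical
  have hCconv : ∀ x ∈ X, Convex ℝ (P \ {latticePoint x}) := fun x hx =>
    (hP.mem_extremePoints_iff_convex_sdiff.1 (hext x hx)).2
  have hcard : ∀ C : Set (Fin n → ℝ), (∀ z, latticePoint z ∈ C ↔ z ∈ T) →
      (intLattice n ∩ C).encard = k := by
    intro C hC
    have : latticePoint ⁻¹' C = (T : Set (Fin n → ℤ)) := by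
      ext z
      simp [hC]
    rw [encard_intLattice_inter, this, Set.encard_coe_eq_coe_finsetCard, hT]
  have hex : ∃ C : Set (Fin n → ℝ), Convex ℝ C ∧ (intLattice n ∩ C).encard = (k : ℕ∞) := by
    refine ⟨P ∩ ⋂ x ∈ X, P \ {latticePoint x},
      hP.inter (convex_iInter₂ hCconv), hcard _ fun z => ?_⟩
    simp only [Set.mem_inter_iff, Set.mem_iInter, Set.mem_sdiff, Set.mem_singleton_iff, hTX,
      latticePoint_injective.eq_iff]
    refine ⟨fun h => h.1.resolve_right fun hz => (h.2 z hz).2 rfl, fun h => ⟨.inl h, fun x hx =>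
      ⟨.inl h, fun e => hdisj x hx (e ▸ h)⟩⟩⟩
  have hlow : ∀ t, IsQuantHellyBound (intLattice n) k t → b ≤ t := by
    intro t ht
    rcases Nat.eq_zero_or_pos X.card with h0 | h0
    · omega
    let e := X.equivFin.symm
    obtain ⟨I, hIt, hI⟩ := ht X.card (fun i => P \ {latticePoint (e i : Fin n → ℤ)}) h0
      (fun i => hCconv _ (e i).2) (hcard _ fun z => by
        simp only [Set.mem_iInter, Set.mem_sdiff, Set.mem_singleton_iff, hTX,
          latticePoint_injective.eq_iff]
        refine ⟨fun h => ?_, fun h i => ⟨.inl h, fun e' => hdisj _ (e i).2 (e' ▸ h)⟩⟩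
        refine (h ⟨0, h0⟩).1.resolve_right fun hz => (h (e.symm ⟨z, hz⟩)).2 ?_
        simp)
    suffices I = Finset.univ by
      rw [this, Finset.card_univ, Fintype.card_fin] at hIt
      omega
    by_contra hne
    obtain ⟨i, hi⟩ : ∃ i, i ∉ I := by simpa [Finset.eq_univ_iff_forall] using hne
    -- Without the `i`-th set, the `i`-th extreme point is a further common lattice point.
    have hsub : (insert (e i : Fin n → ℤ) T : Finset (Fin n → ℤ)) ≤
        latticePoint ⁻¹' (⋂ j ∈ I, P \ {latticePoint (e j : Fin n → ℤ)}) := by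
      intro z hz
      simp only [Set.mem_preimage, Set.mem_iInter, Set.mem_sdiff, Set.mem_singleton_iff, hTX,
        latticePoint_injective.eq_iff]
      intro j hj
      rcases Finset.mem_insert.1 (Finset.mem_coe.1 hz) with rfl | hz
      · refine ⟨.inr (e i).2, fun h => hi ?_⟩
        rwa [e.injective (Subtype.ext h)]
      · exact ⟨.inl hz, fun e' => hdisj _ (e j).2 (e' ▸ hz)⟩
    have h1 := Set.encard_le_encard hsub
    rw [← encard_intLattice_inter, hI, Set.encard_coe_eq_coe_finsetCard,
      Finset.card_insert_of_notMem (hdisj _ (e i).2), hT] at h1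
    have h2 : k + 1 ≤ k := by exact_mod_cast h1
    omega
  have hb : ∃ t, IsQuantHellyBound (intLattice n) k t := ⟨b, isQuantHellyBound_of_midpointsIn hup⟩
  rw [quantHelly, if_pos hex, dif_pos hb]
  have : Nat.find hb = b := le_antisymm (Nat.find_min' hb (isQuantHellyBound_of_midpointsIn hup))
    (hlow _ (Nat.find_spec hb))
  rw [this]

/-- If a proper convex combination of two nonnegative numbers vanishes, both vanish. -/
lemma eq_zero_of_combination {a b u v : ℝ} (ha : 0 < a) (hb : 0 < b) (hu : 0 ≤ u) (hv : 0 ≤ v)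
    (h : a * u + b * v = 0) : u = 0 ∧ v = 0 := by
  have h1 := mul_nonneg ha.le hu
  have h2 := mul_nonneg hb.le hv
  exact ⟨(mul_eq_zero.1 (by linarith : a * u = 0)).resolve_left ha.ne',
    (mul_eq_zero.1 (by linarith : b * v = 0)).resolve_left hb.ne'⟩

lemma eq_of_combination_eq_min {a b c u v : ℝ} (ha : 0 < a) (hb : 0 < b) (hab : a + b = 1)
    (hu : c ≤ u) (hv : c ≤ v) (h : a * u + b * v = c) : u = c ∧ v = c := by
  have := eq_zero_of_combination ha hb (sub_nonneg.2 hu) (sub_nonneg.2 hv)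
    (by linear_combination h - c * hab)
  constructor <;> linarith

lemma eq_of_combination_eq_max {a b c u v : ℝ} (ha : 0 < a) (hb : 0 < b) (hab : a + b = 1)
    (hu : u ≤ c) (hv : v ≤ c) (h : a * u + b * v = c) : u = c ∧ v = c := by
  have := eq_zero_of_combination ha hb (sub_nonneg.2 hu) (sub_nonneg.2 hv)
    (by linear_combination c * hab - h)
  constructor <;> linarith

lemma mem_extremePoints_of_forall {n : ℕ} {P : Set (Fin n → ℝ)} {x : Fin n → ℝ} (hx : x ∈ P)
    (h : ∀ y ∈ P, ∀ z ∈ P, ∀ a b : ℝ, 0 < a → 0 < b → a + b = 1 →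
      (∀ i, a * y i + b * z i = x i) → y = x) : x ∈ P.extremePoints ℝ := by
  refine mem_extremePoints_iff_left.2 ⟨hx, ?_⟩
  rintro y hy z hz ⟨a, b, ha, hb, hab, rfl⟩
  exact h y hy z hz a b ha hb hab fun i => by simp

/-! ### The unit cube -/

lemma quantHelly_intLattice_zero (n : ℕ) :
    quantHelly (intLattice n) 0 = (((2 ^ n : ℕ) : ℕ∞) : WithBot ℕ∞) := by
  have hmem : ∀ z : Fin n → ℤ, latticePoint z ∈ Set.Icc (0 : Fin n → ℝ) 1 ↔
      z ∈ Fintype.piFinset fun _ : Fin n => ({0, 1} : Finset ℤ) := by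
    intro z
    simp only [Set.mem_Icc, Pi.le_def, latticePoint, Pi.zero_apply, Pi.one_apply,
      Fintype.mem_piFinset, Finset.mem_insert, Finset.mem_singleton, ← forall_and]
    refine forall_congr' fun i => ?_
    norm_cast
    omega
  refine quantHelly_eq_of_extremePoints (fun T X h hT => h.card_le_zero hT) (convex_Icc 0 1)
    (T := ∅) (X := Fintype.piFinset fun _ : Fin n => ({0, 1} : Finset ℤ))
    (by simpa using hmem) (by simp) (fun x hx => ?_) rfl (by simp)
  refine mem_extremePoints_of_forall ((hmem x).2 hx) fun y hy z hz a b ha hb hab h => ?_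
  ext i
  have hxi : x i = 0 ∨ x i = 1 := by simpa using Fintype.mem_piFinset.1 hx i
  have hi := h i
  rcases hxi with e | e <;> simp only [latticePoint, e] at hi ⊢ <;> push_cast at hi ⊢
  · exact (eq_of_combination_eq_min ha hb hab (hy.1 i) (hz.1 i) hi).1
  · exact (eq_of_combination_eq_max ha hb hab (hy.2 i) (hz.2 i) hi).1

/-! ### Convex bodies fibered over the difference body of the cube -/

/-- The points `y` for which some `r` with `(y, r) ∈ K` bounds the gauge of the remaining
coordinates `y i`, `d ≤ i`, with respect to the hull of `{0, 1}^(n-d)` and `{0, -1}^(n-d)`. The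
set `K` is meant to restrict only `r` and the first `d` coordinates. -/
def fiberedBody (n d : ℕ) (K : Set ((Fin n → ℝ) × ℝ)) : Set (Fin n → ℝ) :=
  {y | ∃ r, (y, r) ∈ K ∧ 0 ≤ r ∧ ∀ i : Fin n, d ≤ i → y i ≤ r ∧ -y i ≤ r ∧
    ∀ j : Fin n, d ≤ j → y i - y j ≤ r}

/-- Conditions under which the lattice points of `fiberedBody n d K` are the points of `T` and
`X`, whose coordinates from the `d`-th on vanish, and the points of `{0, 1}^n` and
`{0, 1}^d × {0, -1}^(n-d)`: as `r` grows from `0` to `1`, the range of the first `d` coordinates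
shrinks from a polytope to the unit cube. -/
structure IsFiberData (n d : ℕ) (K : Set ((Fin n → ℝ) × ℝ)) (T X : Finset (Fin n → ℤ)) :
    Prop where
  convex : Convex ℝ K
  le_one : ∀ y r, (y, r) ∈ K → r ≤ 1
  mono : ∀ y r, (y, r) ∈ K → 0 ≤ r → (y, 0) ∈ K
  one_iff : ∀ y, (y, 1) ∈ K ↔ ∀ i : Fin n, (i : ℕ) < d → 0 ≤ y i ∧ y i ≤ 1
  mem_iff : ∀ z : Fin n → ℤ, z ∈ T ∨ z ∈ X ↔ (∀ i : Fin n, d ≤ i → z i = 0) ∧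
    (latticePoint z, 0) ∈ K
  notMem : ∀ x ∈ X, x ∉ T
  extreme : ∀ x ∈ X, ∀ y r z s a b, (y, r) ∈ K → (z, s) ∈ K → 0 ≤ r → 0 ≤ s → 0 < a → 0 < b →
    a + b = 1 → (∀ i, a * y i + b * z i = (x i : ℝ)) →
    r = 0 ∧ ∀ i : Fin n, (i : ℕ) < d → y i = x i

/-- The vertices of the cube `{0, 1}^d × {0, ε}^(n-d)`. -/
def signedCube (n d : ℕ) (ε : ℤ) : Finset (Fin n → ℤ) :=
  Fintype.piFinset fun i : Fin n => if (i : ℕ) < d then {0, 1} else {0, ε}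

/-- The vertices of the cube `{0, 1}^d × {0, ε}^(n-d)` with a nonzero coordinate among the last
`n - d`. -/
def properCube (n d : ℕ) (ε : ℤ) : Finset (Fin n → ℤ) :=
  (signedCube n d ε).filter fun z => ∃ i : Fin n, d ≤ i ∧ z i ≠ 0

lemma mem_properCube {n d : ℕ} {ε : ℤ} {z : Fin n → ℤ} :
    z ∈ properCube n d ε ↔ ((∀ i : Fin n, (i : ℕ) < d → z i = 0 ∨ z i = 1) ∧
      ∀ i : Fin n, d ≤ i → z i = 0 ∨ z i = ε) ∧ ∃ i : Fin n, d ≤ i ∧ z i ≠ 0 := by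
  simp only [properCube, signedCube, Finset.mem_filter, Fintype.mem_piFinset, ← forall_and]
  refine and_congr_left fun _ => forall_congr' fun i => ?_
  split_ifs with h
  · simp [h]
  · simp [h, not_lt.1 h]

lemma two_pow_le_card_properCube {n d : ℕ} (hd : d ≤ n) {ε : ℤ} (hε : ε ≠ 0) :
    2 ^ n ≤ (properCube n d ε).card + 2 ^ d := by
  have h1 : (signedCube n d ε).card = 2 ^ n := by
    rw [signedCube, Fintype.card_piFinset]
    calc _ = ∏ _i : Fin n, 2 := Finset.prod_congr rfl fun i _ => by
          split_ifs
          · rfl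
          · exact Finset.card_pair hε.symm
      _ = _ := by simp
  have h2 : ((signedCube n d ε).filter fun z => ¬ ∃ i : Fin n, d ≤ i ∧ z i ≠ 0).card ≤ 2 ^ d := by
    have h3 : (Fintype.piFinset fun i : Fin n =>
        if (i : ℕ) < d then ({0, 1} : Finset ℤ) else {0}).card = 2 ^ d := by
      rw [Fintype.card_piFinset]
      calc _ = ∏ i : Fin n, if (i : ℕ) < d then 2 else 1 := Finset.prod_congr rfl fun i _ => by
            split_ifs <;> rfl
        _ = 2 ^ (Finset.univ.filter fun i : Fin n => (i : ℕ) < d).card := by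
            rw [Finset.prod_ite]; simp
        _ = _ := by rw [Fin.card_filter_val_lt, min_eq_right hd]
    rw [← h3]
    refine Finset.card_le_card fun z hz => ?_
    simp only [signedCube, Finset.mem_filter, Fintype.mem_piFinset] at hz ⊢
    intro i
    have := hz.1 i
    split_ifs at this ⊢ with hi
    · exact this
    · simp only [Finset.mem_singleton]
      by_contra hne
      exact hz.2 ⟨i, not_lt.1 hi, hne⟩
  have h4 := Finset.card_filter_add_card_filter_not (s := signedCube n d ε)
    (fun z => ∃ i : Fin n, d ≤ i ∧ z i ≠ 0)
  rw [h1] at h4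
  have h5 : (properCube n d ε).card =
    ((signedCube n d ε).filter fun z => ∃ i : Fin n, d ≤ i ∧ z i ≠ 0).card := rfl
  omega

namespace IsFiberData

variable {n d : ℕ} {K : Set ((Fin n → ℝ) × ℝ)} {T X : Finset (Fin n → ℤ)}

lemma convex_fiberedBody (h : IsFiberData n d K T X) : Convex ℝ (fiberedBody n d K) := by
  rintro y ⟨r, hr, hr0, hy⟩ z ⟨s, hs, hs0, hz⟩ a b ha hb hab
  refine ⟨a * r + b * s, h.convex hr hs ha hb hab, by positivity, fun i hi => ?_⟩
  obtain ⟨y1, y2, y3⟩ := hy i hi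
  obtain ⟨z1, z2, z3⟩ := hz i hi
  simp only [Pi.add_apply, Pi.smul_apply, smul_eq_mul]
  refine ⟨?_, ?_, fun j hj => ?_⟩
  · linarith [mul_le_mul_of_nonneg_left y1 ha, mul_le_mul_of_nonneg_left z1 hb]
  · linarith [mul_le_mul_of_nonneg_left y2 ha, mul_le_mul_of_nonneg_left z2 hb]
  · linarith [mul_le_mul_of_nonneg_left (y3 j hj) ha, mul_le_mul_of_nonneg_left (z3 j hj) hb]

lemma latticePoint_mem_of_properCube (h : IsFiberData n d K T X) {ε : ℤ} (hε : ε = 1 ∨ ε = -1)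
    {z : Fin n → ℤ} (hz : z ∈ properCube n d ε) : latticePoint z ∈ fiberedBody n d K := by
  obtain ⟨⟨h1, h2⟩, -⟩ := mem_properCube.1 hz
  refine ⟨1, (h.one_iff _).2 fun i hi => ?_, zero_le_one, fun i hi => ⟨?_, ?_, fun j hj => ?_⟩⟩
  · have := h1 i hi
    simp only [latticePoint]
    norm_cast
    omega
  · have := h2 i hi
    simp only [latticePoint]
    norm_cast
    omega
  · have := h2 i hi
    simp only [latticePoint]
    norm_cast
    omega
  · have := h2 i hi
    have := h2 j hj
    simp only [latticePoint]
    norm_cast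
    omega

lemma latticePoint_mem_iff (h : IsFiberData n d K T X) (z : Fin n → ℤ) :
    latticePoint z ∈ fiberedBody n d K ↔
      (z ∈ T ∨ z ∈ X) ∨ z ∈ properCube n d 1 ∨ z ∈ properCube n d (-1) := by
  constructor
  · rintro ⟨r, hr, hr0, hz⟩
    by_cases htail : ∀ i : Fin n, d ≤ i → z i = 0
    · exact .inl ((h.mem_iff z).2 ⟨htail, h.mono _ _ hr hr0⟩)
    push Not at htail
    obtain ⟨j, hj, hzj⟩ := htail
    have hr1 := h.le_one _ _ hr
    have hj1 := hz j hj
    simp only [latticePoint] at hj1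
    have hrle : 1 ≤ r := by
      rcases lt_or_gt_of_ne hzj with hneg | hpos
      · have : (z j : ℝ) ≤ -1 := by exact_mod_cast (by omega : z j ≤ -1)
        linarith [hj1.2.1]
      · have : (1 : ℝ) ≤ z j := by exact_mod_cast (by omega : 1 ≤ z j)
        linarith [hj1.1]
    obtain rfl : r = 1 := le_antisymm hr1 hrle
    have hhead : ∀ i : Fin n, (i : ℕ) < d → z i = 0 ∨ z i = 1 := by
      intro i hi
      have := (h.one_iff _).1 hr i hi
      simp only [latticePoint] at this
      norm_cast at this
      omega
    have hint : ∀ i : Fin n, d ≤ i → z i ≤ 1 ∧ -z i ≤ 1 ∧ ∀ j : Fin n, d ≤ j → z i - z j ≤ 1 := by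
      intro i hi
      have := hz i hi
      simp only [latticePoint] at this
      exact_mod_cast this
    right
    have hj2 := hint j hj
    rcases lt_or_gt_of_ne hzj with hneg | hpos
    · refine .inr (mem_properCube.2 ⟨⟨hhead, fun i hi => ?_⟩, j, hj, hzj⟩)
      have := hint i hi
      have := this.2.2 j hj
      omega
    · refine .inl (mem_properCube.2 ⟨⟨hhead, fun i hi => ?_⟩, j, hj, hzj⟩)
      have := hint i hi
      have := hj2.2.2 i hi
      omega
  · rintro (hz | hz | hz)
    · obtain ⟨h1, h2⟩ := (h.mem_iff z).1 hz
      refine ⟨0, h2, le_rfl, fun i hi => ?_⟩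
      simp only [latticePoint, h1 i hi]
      refine ⟨by simp, by simp, fun j hj => by simp [h1 j hj]⟩
    · exact h.latticePoint_mem_of_properCube (.inl rfl) hz
    · exact h.latticePoint_mem_of_properCube (.inr rfl) hz

/-- A coordinate `d ≤ j` in which `x` equals `ε = ± 1` forces `r = 1` at the ends of any segment
through `x`, and then all other coordinates range over intervals of length one with the
coordinates of `x` as end points. -/
lemma mem_extremePoints_of_properCube (h : IsFiberData n d K T X) {ε : ℤ} (hε : ε = 1 ∨ ε = -1)
    {x : Fin n → ℤ} (hx : x ∈ properCube n d ε) :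
    latticePoint x ∈ (fiberedBody n d K).extremePoints ℝ := by
  refine mem_extremePoints_of_forall (h.latticePoint_mem_of_properCube hε hx) ?_
  rintro y ⟨r, hr, hr0, hy⟩ z ⟨s, hs, hs0, hz⟩ a b ha hb hab hc
  obtain ⟨⟨h1, h2⟩, j, hj, hxj⟩ := mem_properCube.1 hx
  have hr1 := h.le_one _ _ hr
  have hs1 := h.le_one _ _ hs
  have hj2 := (h2 j hj).resolve_left hxj
  have hcj := hc j
  have hyj := hy j hj
  have hzj := hz j hj
  have hhead : r = 1 → s = 1 → ∀ i : Fin n, (i : ℕ) < d → y i = x i := by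
    rintro rfl rfl i hi
    have hyi := (h.one_iff _).1 hr i hi
    have hzi := (h.one_iff _).1 hs i hi
    have hi := hc i
    rcases h1 i ‹_› with e | e <;> simp only [latticePoint, e] at hi ⊢ <;> push_cast at hi ⊢
    · exact (eq_of_combination_eq_min ha hb hab hyi.1 hzi.1 hi).1
    · exact (eq_of_combination_eq_max ha hb hab hyi.2 hzi.2 hi).1
  rcases hε with rfl | rfl
  · simp only [latticePoint, hj2, Int.cast_one] at hcj
    obtain ⟨ey, ez⟩ := eq_of_combination_eq_max ha hb hab (hyj.1.trans hr1) (hzj.1.trans hs1) hcj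
    have er : r = 1 := by linarith [hyj.1]
    have es : s = 1 := by linarith [hzj.1]
    ext i
    rcases lt_or_ge (i : ℕ) d with hi | hi
    · exact hhead er es i hi
    have hyi := hy i hi
    have hzi := hz i hi
    have hyji := hyj.2.2 i hi
    have hzji := hzj.2.2 i hi
    have hci := hc i
    rcases h2 i hi with e | e <;> simp only [latticePoint, e] at hci ⊢ <;> push_cast at hci ⊢
    · exact (eq_of_combination_eq_min ha hb hab (by linarith) (by linarith) hci).1
    · exact (eq_of_combination_eq_max ha hb hab (hyi.1.trans hr1) (hzi.1.trans hs1) hci).1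
  · simp only [latticePoint, hj2, Int.cast_neg, Int.cast_one] at hcj
    obtain ⟨ey, ez⟩ := eq_of_combination_eq_min ha hb hab (by linarith [hyj.2.1])
      (by linarith [hzj.2.1]) hcj
    have er : r = 1 := by linarith [hyj.2.1]
    have es : s = 1 := by linarith [hzj.2.1]
    ext i
    rcases lt_or_ge (i : ℕ) d with hi | hi
    · exact hhead er es i hi
    have hyi := hy i hi
    have hzi := hz i hi
    have hyij := hyi.2.2 j hj
    have hzij := hzi.2.2 j hj
    have hci := hc i
    rcases h2 i hi with e | e <;> simp only [latticePoint, e] at hci ⊢ <;> push_cast at hci ⊢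
    · exact (eq_of_combination_eq_max ha hb hab (by linarith) (by linarith) hci).1
    · exact (eq_of_combination_eq_min ha hb hab (by linarith [hyi.2.1])
        (by linarith [hzi.2.1]) hci).1

lemma mem_extremePoints_of_mem (h : IsFiberData n d K T X) {x : Fin n → ℤ} (hx : x ∈ X) :
    latticePoint x ∈ (fiberedBody n d K).extremePoints ℝ := by
  refine mem_extremePoints_of_forall ((h.latticePoint_mem_iff x).2 (.inl (.inr hx))) ?_
  rintro y ⟨r, hr, hr0, hy⟩ z ⟨s, hs, hs0, hz⟩ a b ha hb hab hc
  obtain ⟨rfl, hhead⟩ := h.extreme x hx y r z s a b hr hs hr0 hs0 ha hb hab hc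
  have htail := ((h.mem_iff x).1 (.inr hx)).1
  ext i
  rcases lt_or_ge (i : ℕ) d with hi | hi
  · exact hhead i hi
  · have hyi := hy i hi
    simp only [latticePoint, htail i hi, Int.cast_zero]
    linarith

/-- The fibered body determines a quantitative Helly number if the number of its extreme lattice
points, `2 * (2 ^ n - 2 ^ d) + |X|`, attains an upper bound. -/
theorem quantHelly_eq (h : IsFiberData n d K T X) (hd : d ≤ n) {k b : ℕ}
    (hup : ∀ T X : Finset (Fin n → ℤ), MidpointsIn T X → T.card = k → X.card ≤ b)
    (hT : T.card = k) (hX : b + 2 ^ (d + 1) ≤ 2 ^ (n + 1) + X.card) :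
    quantHelly (intLattice n) k = ((b : ℕ∞) : WithBot ℕ∞) := by
  have hnot : ∀ {ε : ℤ} {z : Fin n → ℤ}, z ∈ properCube n d ε → ¬ (z ∈ T ∨ z ∈ X) := by
    intro ε z hz hTX
    obtain ⟨-, i, hi, hne⟩ := mem_properCube.1 hz
    exact hne (((h.mem_iff z).1 hTX).1 i hi)
  refine quantHelly_eq_of_extremePoints hup h.convex_fiberedBody (T := T)
    (X := X ∪ (properCube n d 1 ∪ properCube n d (-1))) (fun z => ?_) (fun x hx hxT => ?_)
    (fun x hx => ?_) hT ?_
  · rw [h.latticePoint_mem_iff, Finset.mem_union, Finset.mem_union, or_assoc]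
  · simp only [Finset.mem_union] at hx
    rcases hx with hx | hx | hx
    · exact h.notMem x hx hxT
    · exact hnot hx (.inl hxT)
    · exact hnot hx (.inl hxT)
  · simp only [Finset.mem_union] at hx
    rcases hx with hx | hx | hx
    · exact h.mem_extremePoints_of_mem hx
    · exact h.mem_extremePoints_of_properCube (.inl rfl) hx
    · exact h.mem_extremePoints_of_properCube (.inr rfl) hx
  · rw [Finset.card_union_of_disjoint, Finset.card_union_of_disjoint]
    · have h1 := two_pow_le_card_properCube hd (ε := 1) (by norm_num)
      have h2 := two_pow_le_card_properCube hd (ε := -1) (by norm_num)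
      rw [pow_succ] at hX
      rw [pow_succ 2 n] at hX
      omega
    · rw [Finset.disjoint_left]
      intro z hz hz'
      obtain ⟨⟨-, h1⟩, i, hi, hne⟩ := mem_properCube.1 hz
      have h2 := h1 i hi
      have h3 := (mem_properCube.1 hz').1.2 i hi
      omega
    · rw [Finset.disjoint_left]
      intro z hz hz'
      rcases Finset.mem_union.1 hz' with hz' | hz'
      · exact hnot hz' (.inr hz)
      · exact hnot hz' (.inr hz)

end IsFiberData

/-! ### The lattice polytopes with one to four non-extreme lattice points -/

lemma quantHelly_intLattice_one {n : ℕ} (hn : 2 ≤ n) :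
    quantHelly (intLattice n) 1 = (((2 ^ (n + 1) - 2 : ℕ) : ℕ∞) : WithBot ℕ∞) := by
  have hdata : IsFiberData n 0 {p | p.2 ≤ 1} {0} ∅ :=
    { convex := by
        rintro ⟨y, r⟩ hr ⟨z, s⟩ hs a b ha hb hab
        simp only [Set.mem_ofPred_eq, Prod.snd_add, Prod.smul_snd, smul_eq_mul] at *
        nlinarith
      le_one := fun _ _ h => h
      mono := by simp
      one_iff := by simp
      mem_iff := fun z => by simp [funext_iff]
      notMem := by simp
      extreme := by simp }
  refine hdata.quantHelly_eq (by omega) (fun T X h hT => h.card_le_one hT) rfl ?_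
  have : 2 ^ 1 ≤ 2 ^ (n + 1) := Nat.pow_le_pow_right (by norm_num) (by omega)
  simp
  omega

/-- The lattice vector `(p.1, p.2, 0, …, 0)`. -/
def planarPoint (n : ℕ) (p : ℤ × ℤ) : Fin n → ℤ :=
  fun i => if (i : ℕ) = 0 then p.1 else if (i : ℕ) = 1 then p.2 else 0

lemma planarPoint_injective {n : ℕ} (hn : 2 ≤ n) : Function.Injective (planarPoint n) := by
  intro p q h
  have h0 := congrFun h ⟨0, by omega⟩
  have h1 := congrFun h ⟨1, by omega⟩
  simp only [planarPoint, if_true, one_ne_zero, if_false] at h0 h1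
  exact Prod.ext h0 h1

lemma planarPoint_eq_iff {n : ℕ} (hn : 2 ≤ n) (p : ℤ × ℤ) (z : Fin n → ℤ) :
    planarPoint n p = z ↔ z ⟨0, by omega⟩ = p.1 ∧ z ⟨1, by omega⟩ = p.2 ∧
      ∀ i : Fin n, 2 ≤ (i : ℕ) → z i = 0 := by
  constructor
  · rintro rfl
    refine ⟨rfl, rfl, fun i hi => ?_⟩
    simp only [planarPoint]
    rw [if_neg (by omega), if_neg (by omega)]
  · rintro ⟨h0, h1, h2⟩
    ext i
    simp only [planarPoint]
    split_ifs with hi hi'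
    · rw [← h0]; congr 1; exact Fin.ext hi.symm
    · rw [← h1]; congr 1; exact Fin.ext hi'.symm
    · exact (h2 i (by omega)).symm

/-- Over the segment from `-1` to `k` on the first axis, which has `k` lattice points in its
interior. For `k = 1` its end point `1` would not be extreme in the fibered body, being the midpoint
of points over opposite vertices. -/
lemma isFiberData_segment {n : ℕ} (hn : 2 ≤ n) {k : ℕ} (hk : 2 ≤ k) :
    IsFiberData n 1
      {p | p.2 ≤ 1 ∧ p.2 ≤ p.1 ⟨0, by omega⟩ + 1 ∧ (k - 1) * p.2 ≤ k - p.1 ⟨0, by omega⟩}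
      ((Finset.range k).image fun j : ℕ => planarPoint n (j, 0))
      (({((-1 : ℤ), (0 : ℤ)), ((k : ℤ), (0 : ℤ))} : Finset (ℤ × ℤ)).image (planarPoint n)) := by
  have hk' : (2 : ℝ) ≤ k := by exact_mod_cast hk
  have hhead : ∀ i : Fin n, (i : ℕ) < 1 → i = ⟨0, by omega⟩ := fun i hi =>
    Fin.ext (Nat.lt_one_iff.1 hi)
  constructor
  · rintro ⟨y, r⟩ ⟨h1, h2, h3⟩ ⟨z, s⟩ ⟨h1', h2', h3'⟩ a b ha hb hab
    obtain rfl : b = 1 - a := by linarith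
    simp only [Set.mem_ofPred_eq, Prod.snd_add, Prod.smul_snd, smul_eq_mul, Prod.fst_add,
      Prod.smul_fst, Pi.add_apply, Pi.smul_apply] at *
    refine ⟨?_, ?_, ?_⟩
    · linarith [mul_le_mul_of_nonneg_left h1 ha, mul_le_mul_of_nonneg_left h1' hb]
    · linarith [mul_le_mul_of_nonneg_left h2 ha, mul_le_mul_of_nonneg_left h2' hb]
    · linarith [mul_le_mul_of_nonneg_left h3 ha, mul_le_mul_of_nonneg_left h3' hb]
  · exact fun y r h => h.1
  · rintro y r ⟨h1, h2, h3⟩ hr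
    have := mul_nonneg (by linarith : (0 : ℝ) ≤ k - 1) hr
    simp only [Set.mem_ofPred_eq] at *
    refine ⟨zero_le_one, by linarith, by linarith⟩
  · intro y
    constructor
    · rintro ⟨-, h2, h3⟩ i hi
      rw [hhead i hi]
      simp only at h2 h3
      constructor <;> linarith
    · intro h
      obtain ⟨h1, h2⟩ := h ⟨0, by omega⟩ (by simp)
      refine ⟨le_rfl, ?_, ?_⟩ <;> simp only <;> linarith
  · intro z
    simp only [Finset.mem_image, Finset.mem_range, Finset.mem_insert, Finset.mem_singleton,
      exists_eq_or_imp, exists_eq_left, planarPoint_eq_iff hn, Set.mem_ofPred_eq, latticePoint]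
    have e1 : ((0 : ℝ) ≤ 1 ∧ (0 : ℝ) ≤ z ⟨0, by omega⟩ + 1 ∧
        ((k : ℝ) - 1) * 0 ≤ k - z ⟨0, by omega⟩) ↔
        -1 ≤ z ⟨0, by omega⟩ ∧ z ⟨0, by omega⟩ ≤ k := by
      rw [mul_zero, sub_nonneg, ← neg_le_iff_add_nonneg]
      norm_cast
      simp
    have e2 : (∀ i : Fin n, 1 ≤ (i : ℕ) → z i = 0) ↔
        z ⟨1, by omega⟩ = 0 ∧ ∀ i : Fin n, 2 ≤ (i : ℕ) → z i = 0 := by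
      refine ⟨fun h => ⟨h _ le_rfl, fun i hi => h i (by omega)⟩, fun h i hi => ?_⟩
      rcases hi.eq_or_lt with hi | hi
      · rw [← h.1]; congr 1; exact Fin.ext hi.symm
      · exact h.2 i hi
    rw [e1, e2]
    constructor
    · rintro (⟨j, hj, h0, h1, h2⟩ | ⟨h0, h1, h2⟩ | ⟨h0, h1, h2⟩)
      · exact ⟨⟨h1, h2⟩, by omega, by omega⟩
      · exact ⟨⟨h1, h2⟩, by omega, by omega⟩
      · exact ⟨⟨h1, h2⟩, by omega, by omega⟩
    · rintro ⟨⟨h1, h2⟩, h3, h4⟩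
      by_cases h5 : z ⟨0, by omega⟩ = -1
      · exact .inr (.inl ⟨h5, h1, h2⟩)
      by_cases h6 : z ⟨0, by omega⟩ = k
      · exact .inr (.inr ⟨h6, h1, h2⟩)
      · exact .inl ⟨(z ⟨0, by omega⟩).toNat, by omega, by omega, h1, h2⟩
  · intro x hx hxT
    simp only [Finset.mem_image, Finset.mem_range, Finset.mem_insert, Finset.mem_singleton,
      exists_eq_or_imp, exists_eq_left, planarPoint_eq_iff hn] at hx hxT
    obtain ⟨j, hj, h1, -⟩ := hxT
    rcases hx with ⟨h0, -⟩ | ⟨h0, -⟩ <;> omega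
  · rintro x hx y r z s a b ⟨h1, h2, h3⟩ ⟨h1', h2', h3'⟩ hr hs ha hb hab hc
    have hc0 := hc ⟨0, by omega⟩
    have hkr := mul_nonneg (by linarith : (0 : ℝ) ≤ k - 1) hr
    have hks := mul_nonneg (by linarith : (0 : ℝ) ≤ k - 1) hs
    simp only [Finset.mem_image, Finset.mem_insert, Finset.mem_singleton,
      exists_eq_or_imp, exists_eq_left, planarPoint_eq_iff hn] at hx
    simp only at h2 h3 h2' h3'
    have key : r = 0 ∧ y ⟨0, by omega⟩ = x ⟨0, by omega⟩ := by
      rcases hx with ⟨h0, -⟩ | ⟨h0, -⟩ <;> rw [h0] at hc0 ⊢ <;> push_cast at hc0 ⊢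
      · obtain ⟨e, -⟩ := eq_of_combination_eq_min ha hb hab (by linarith) (by linarith) hc0
        exact ⟨by linarith, e⟩
      · obtain ⟨e, -⟩ := eq_of_combination_eq_max ha hb hab (by linarith) (by linarith) hc0
        refine ⟨?_, e⟩
        have : ((k : ℝ) - 1) * r = 0 := by linarith
        exact (mul_eq_zero.1 this).resolve_left (by linarith)
    refine ⟨key.1, fun i hi => ?_⟩
    rw [hhead i hi]
    exact key.2

lemma quantHelly_intLattice_of_segment {n : ℕ} (hn : 2 ≤ n) {k : ℕ} (hk : 2 ≤ k)
    (hup : ∀ T X : Finset (Fin n → ℤ), MidpointsIn T X → T.card = k →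
      X.card ≤ 2 ^ (n + 1) - 2) :
    quantHelly (intLattice n) k = (((2 ^ (n + 1) - 2 : ℕ) : ℕ∞) : WithBot ℕ∞) := by
  refine (isFiberData_segment hn hk).quantHelly_eq (by omega) hup ?_ ?_
  · rw [Finset.card_image_of_injective, Finset.card_range]
    intro i j hij
    simpa using planarPoint_injective hn hij
  · rw [Finset.card_image_of_injective _ (planarPoint_injective hn), Finset.card_pair]
    · have : 2 ^ 1 ≤ 2 ^ (n + 1) := Nat.pow_le_pow_right (by norm_num) (by omega)
      omega
    · intro e
      have := congrArg Prod.fst e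
      simp only at this
      omega

/-- The vertices of the octagon obtained from the square `[-1, 2]²` by cutting off its corners. -/
def octagonVertices : Finset (ℤ × ℤ) :=
  {(2, 0), (2, 1), (1, 2), (0, 2), (-1, 1), (-1, 0), (0, -1), (1, -1)}

/-- Over the octagon. Each of its inequalities `0 ≤ g` is replaced by `r ≤ g`, which for `r = 1`
leaves the unit square. -/
lemma isFiberData_octagon {n : ℕ} (hn : 2 ≤ n) :
    IsFiberData n 2
      {p | p.2 ≤ 1 ∧ p.2 ≤ p.1 ⟨0, by omega⟩ + 1 ∧ p.2 ≤ p.1 ⟨1, by omega⟩ + 1 ∧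
        p.2 ≤ 2 - p.1 ⟨0, by omega⟩ ∧ p.2 ≤ 2 - p.1 ⟨1, by omega⟩ ∧
        p.2 ≤ p.1 ⟨0, by omega⟩ + p.1 ⟨1, by omega⟩ + 1 ∧
        p.2 ≤ 3 - (p.1 ⟨0, by omega⟩ + p.1 ⟨1, by omega⟩) ∧
        p.2 ≤ p.1 ⟨0, by omega⟩ - p.1 ⟨1, by omega⟩ + 2 ∧
        p.2 ≤ p.1 ⟨1, by omega⟩ - p.1 ⟨0, by omega⟩ + 2}
      (({(0, 0), (0, 1), (1, 0), (1, 1)} : Finset (ℤ × ℤ)).image (planarPoint n))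
      (octagonVertices.image (planarPoint n)) := by
  constructor
  · rintro ⟨y, r⟩ h ⟨z, s⟩ h' a b ha hb hab
    obtain rfl : b = 1 - a := by linarith
    simp only [Set.mem_ofPred_eq, Prod.snd_add, Prod.smul_snd, smul_eq_mul, Prod.fst_add,
      Prod.smul_fst, Pi.add_apply, Pi.smul_apply] at *
    obtain ⟨h1, h2, h3, h4, h5, h6, h7, h8, h9⟩ := h
    obtain ⟨i1, i2, i3, i4, i5, i6, i7, i8, i9⟩ := h'
    refine ⟨?_, ?_, ?_, ?_, ?_, ?_, ?_, ?_, ?_⟩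
    · linarith [mul_le_mul_of_nonneg_left h1 ha, mul_le_mul_of_nonneg_left i1 hb]
    · linarith [mul_le_mul_of_nonneg_left h2 ha, mul_le_mul_of_nonneg_left i2 hb]
    · linarith [mul_le_mul_of_nonneg_left h3 ha, mul_le_mul_of_nonneg_left i3 hb]
    · linarith [mul_le_mul_of_nonneg_left h4 ha, mul_le_mul_of_nonneg_left i4 hb]
    · linarith [mul_le_mul_of_nonneg_left h5 ha, mul_le_mul_of_nonneg_left i5 hb]
    · linarith [mul_le_mul_of_nonneg_left h6 ha, mul_le_mul_of_nonneg_left i6 hb]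
    · linarith [mul_le_mul_of_nonneg_left h7 ha, mul_le_mul_of_nonneg_left i7 hb]
    · linarith [mul_le_mul_of_nonneg_left h8 ha, mul_le_mul_of_nonneg_left i8 hb]
    · linarith [mul_le_mul_of_nonneg_left h9 ha, mul_le_mul_of_nonneg_left i9 hb]
  · exact fun y r h => h.1
  · rintro y r ⟨h1, h2, h3, h4, h5, h6, h7, h8, h9⟩ hr
    exact ⟨zero_le_one, hr.trans h2, hr.trans h3, hr.trans h4, hr.trans h5, hr.trans h6,
      hr.trans h7, hr.trans h8, hr.trans h9⟩
  · intro y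
    simp only [Set.mem_ofPred_eq]
    constructor
    · rintro ⟨h1, h2, h3, h4, h5, -⟩ ⟨i, hin⟩ hi
      interval_cases i
      · constructor <;> linarith
      · constructor <;> linarith
    · intro h
      obtain ⟨h1, h2⟩ := h ⟨0, by omega⟩ (by simp)
      obtain ⟨h3, h4⟩ := h ⟨1, by omega⟩ (by simp)
      refine ⟨?_, ?_, ?_, ?_, ?_, ?_, ?_, ?_, ?_⟩ <;> linarith
  · intro z
    simp only [octagonVertices, Finset.mem_image, Finset.mem_insert, Finset.mem_singleton,
      exists_eq_or_imp, exists_eq_left, planarPoint_eq_iff hn, Set.mem_ofPred_eq, latticePoint]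
    norm_cast
    generalize z ⟨0, by omega⟩ = p
    generalize z ⟨1, by omega⟩ = q
    generalize (∀ i : Fin n, 2 ≤ (i : ℕ) → z i = 0) = H
    constructor
    · intro h
      refine ⟨by tauto, ?_⟩
      omega
    · rintro ⟨h, h1⟩
      simp only [h, and_true]
      have hp : -1 ≤ p ∧ p ≤ 2 := by omega
      obtain ⟨hp1, hp2⟩ := hp
      interval_cases p <;> omega
  · intro x hx hxT
    obtain ⟨p, hp, rfl⟩ := Finset.mem_image.1 hx
    obtain ⟨q, hq, e⟩ := Finset.mem_image.1 hxT
    rw [planarPoint_injective hn e] at hq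
    have hne : ∀ p ∈ octagonVertices,
        p ∉ ({(0, 0), (0, 1), (1, 0), (1, 1)} : Finset (ℤ × ℤ)) := by decide
    exact hne p hp hq
  · rintro x hx y r z s a b ⟨h1, h2, h3, h4, h5, h6, h7, h8, h9⟩
      ⟨i1, i2, i3, i4, i5, i6, i7, i8, i9⟩ hr hs ha hb hab hc
    have hc0 := hc ⟨0, by omega⟩
    have hc1 := hc ⟨1, by omega⟩
    simp only at h2 h3 h4 h5 h6 h7 h8 h9 i2 i3 i4 i5 i6 i7 i8 i9
    -- An inequality that is tight at `x` is tight at both ends of a segment through `x`.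
    have tight : ∀ α β γ : ℝ, r ≤ α * y ⟨0, by omega⟩ + β * y ⟨1, by omega⟩ + γ →
        s ≤ α * z ⟨0, by omega⟩ + β * z ⟨1, by omega⟩ + γ →
        α * x ⟨0, by omega⟩ + β * x ⟨1, by omega⟩ + γ = 0 →
        α * y ⟨0, by omega⟩ + β * y ⟨1, by omega⟩ + γ = 0 := by
      intro α β γ hy hz hx
      exact (eq_zero_of_combination ha hb (hr.trans hy) (hs.trans hz) (by
        linear_combination α * hc0 + β * hc1 + γ * hab + hx)).1
    have t2 := tight 1 0 1 (by linarith) (by linarith)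
    have t3 := tight 0 1 1 (by linarith) (by linarith)
    have t4 := tight (-1) 0 2 (by linarith) (by linarith)
    have t5 := tight 0 (-1) 2 (by linarith) (by linarith)
    have t6 := tight 1 1 1 (by linarith) (by linarith)
    have t7 := tight (-1) (-1) 3 (by linarith) (by linarith)
    have t8 := tight 1 (-1) 2 (by linarith) (by linarith)
    have t9 := tight (-1) 1 2 (by linarith) (by linarith)
    clear tight
    suffices r = 0 ∧ y ⟨0, by omega⟩ = x ⟨0, by omega⟩ ∧ y ⟨1, by omega⟩ = x ⟨1, by omega⟩ by
      refine ⟨this.1, ?_⟩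
      rintro ⟨i, hin⟩ hi
      interval_cases i
      · exact this.2.1
      · exact this.2.2
    simp only [octagonVertices, Finset.mem_image, Finset.mem_insert, Finset.mem_singleton,
      exists_eq_or_imp, exists_eq_left, planarPoint_eq_iff hn] at hx
    rcases hx with h | h | h | h | h | h | h | h <;> obtain ⟨e0, e1, -⟩ := h <;>
      rw [e0, e1] at t2 t3 t4 t5 t6 t7 t8 t9 ⊢ <;> push_cast at t2 t3 t4 t5 t6 t7 t8 t9 ⊢
    · have := t4 (by norm_num)
      have := t9 (by norm_num)
      refine ⟨?_, ?_, ?_⟩ <;> linarith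
    · have := t4 (by norm_num)
      have := t7 (by norm_num)
      refine ⟨?_, ?_, ?_⟩ <;> linarith
    · have := t5 (by norm_num)
      have := t7 (by norm_num)
      refine ⟨?_, ?_, ?_⟩ <;> linarith
    · have := t5 (by norm_num)
      have := t8 (by norm_num)
      refine ⟨?_, ?_, ?_⟩ <;> linarith
    · have := t2 (by norm_num)
      have := t8 (by norm_num)
      refine ⟨?_, ?_, ?_⟩ <;> linarith
    · have := t2 (by norm_num)
      have := t6 (by norm_num)
      refine ⟨?_, ?_, ?_⟩ <;> linarith
    · have := t3 (by norm_num)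
      have := t6 (by norm_num)
      refine ⟨?_, ?_, ?_⟩ <;> linarith
    · have := t3 (by norm_num)
      have := t9 (by norm_num)
      refine ⟨?_, ?_, ?_⟩ <;> linarith

lemma quantHelly_intLattice_four {n : ℕ} (hn : 2 ≤ n) :
    quantHelly (intLattice n) 4 = (((2 ^ (n + 1) : ℕ) : ℕ∞) : WithBot ℕ∞) := by
  refine (isFiberData_octagon hn).quantHelly_eq hn (fun T X h hT => h.card_le_four hT) ?_ ?_
  · rw [Finset.card_image_of_injective _ (planarPoint_injective hn)]
    rfl
  · rw [Finset.card_image_of_injective _ (planarPoint_injective hn)]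
    exact Nat.le_refl _

theorem mainTheorem3 (n : ℕ) (hn : 2 ≤ n) :
    quantHelly (intLattice n) 0 = (((2 ^ n : ℕ) : ℕ∞) : WithBot ℕ∞) ∧
    quantHelly (intLattice n) 1 = (((2 ^ (n + 1) - 2 : ℕ) : ℕ∞) : WithBot ℕ∞) ∧
    quantHelly (intLattice n) 2 = (((2 ^ (n + 1) - 2 : ℕ) : ℕ∞) : WithBot ℕ∞) ∧
    quantHelly (intLattice n) 3 = (((2 ^ (n + 1) - 2 : ℕ) : ℕ∞) : WithBot ℕ∞) ∧
    quantHelly (intLattice n) 4 = (((2 ^ (n + 1) : ℕ) : ℕ∞) : WithBot ℕ∞) := by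
  exact ⟨quantHelly_intLattice_zero n, quantHelly_intLattice_one hn,
    quantHelly_intLattice_of_segment hn le_rfl fun T X h hT => h.card_le_two hT,
    quantHelly_intLattice_of_segment hn (by norm_num) fun T X h hT => h.card_le_three hT,
    quantHelly_intLattice_four hn⟩
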